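/- Let $0<\delta<1$, let $k\ge 1$, $m>1$ and $\ell\ge 0$ be integers, and let $\|\cdot\|$ be a sub-multiplicative norm on the real $k\times k$ matrices. **Definitions.** A real $k\times k$ matrix $A$ is called $\delta$-condense if all its eigenvalues are real, its spectral radius is at most $1$, and every eigenvalue of $A$ in $[-1,-\delta]\cup[\delta,1]$ is semisimple (its algebraic multiplicity equals its geometric multiplicity). Let $T_n$ be the Chebyshev polynomials of the first kind. For $f$ on $[-1,1]$ put $$\alpha_n[f]=\frac{2}{\pi}\int_{-1}^{1}\frac{f(t)T_n(t)}{\sqrt{1-t^2}}\,dt,\qquad \mathcal S_N(f)(A)=\tfrac12\alpha_0[f]\,T_0(A)+\sum_{n=1}^{N}\alpha_n[f]\,T_n(A).$$ If $A=Z^{-1}JZ$ is a Jordan form of $A$, with $J$ block diagonal with Jordan blocks $J_i$ of size $k_i\times k_i$ and eigenvalue $\lambda_i$, then $f(A)=Z^{-1}f(J)Z$, where $f(J)$ is block diagonal with the blocks $f(J_i)$; here $f(J_i)$ is the upper triangular matrix with $(p,j)$ entry $\frac{f^{(j-p)}(\lambda_i)}{(j-p)!}$ for $p\le j$ (derivatives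 at $\pm1$ are one-sided). **Statement.** Let $f\in C^{m-1+\ell}([-1,1])$ be such that $f^{(m-1+\ell)}$ is absolutely continuous and its derivative $f^{(m+\ell)}$ (which exists almost everywhere) is of bounded variation, i.e. agrees almost everywhere with a function of bounded variation on $[-1,1]$. Then there is a constant $C_0$, depending only on $f,\ell,m,\delta$ and the norm $\|\cdot\|$ (hence on $k$), such that for every $\delta$-condense $k\times k$ matrix $A$ whose largest Jordan block has size $m$, and every Jordan form $A=Z^{-1}JZ$, $$\|\mathcal S_N(f)(A)-f(A)\|\le \frac{C}{(N-(m+\ell))^{\ell+1}},\qquad C=C_0\,\|Z^{-1}\|\,\|Z\|,\qquad\text{for all } N>m+\ell .$$ In particular, for each such $A$ the bound holds with a constant $C$ independent of $N$. -/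

import Mathlib

/-- The derivative of `g` on `[-1, 1]` is of bounded variation: it exists almost everywhere and
agrees almost everywhere with a function of bounded variation on `[-1, 1]`. -/
def HasDerivOfBoundedVariation (g : ℝ → ℝ) : Prop :=
  ∃ h : ℝ → ℝ, BoundedVariationOn h (Set.Icc (-1) 1) ∧
    ∀ᵐ x ∂(MeasureTheory.volume.restrict (Set.Icc (-1 : ℝ) 1)), HasDerivAt g (h x) x

/-- The chebyshev coefficient `α_n[f] = (2/π) ∫_{-1}^{1} f(t) T_n(t) / √(1 - t²) dt`. -/
noncomputable def chebyshevCoeff (f : ℝ → ℝ) (n : ℕ) : ℝ :=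
  2 / Real.pi *
    ∫ t in (-1 : ℝ)..1, f t * (Polynomial.Chebyshev.T ℝ (n : ℤ)).eval t / Real.sqrt (1 - t ^ 2)

/-- The truncated matrix Chebyshev expansion
`S_N(f)(A) = α_0[f] T_0(A) / 2 + ∑_{n=1}^{N} α_n[f] T_n(A)`. -/
noncomputable def chebyshevPartialSum {k : ℕ} (N : ℕ) (f : ℝ → ℝ)
    (A : Matrix (Fin k) (Fin k) ℝ) : Matrix (Fin k) (Fin k) ℝ :=
  ∑ n ∈ Finset.range (N + 1),
    ((if n = 0 then 1 / 2 else 1) * chebyshevCoeff f n) •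
      Polynomial.aeval A (Polynomial.Chebyshev.T ℝ (n : ℤ))

/-- The `n × n` Jordan block with eigenvalue `lam`: `lam` on the diagonal, ones on the
superdiagonal. -/
def jordanBlock (n : ℕ) (lam : ℝ) : Matrix (Fin n) (Fin n) ℝ :=
  Matrix.of fun i j => if i = j then lam else if (i : ℕ) + 1 = (j : ℕ) then 1 else 0

/-- The value of `f` at the `n × n` Jordan block with eigenvalue `lam`: the upper triangular matrix
with entries `f^{(j-i)}(lam) / (j-i)!` for `i ≤ j`. Derivatives are taken within `[-1, 1]`, that is,
they are one-sided at the endpoints. -/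
noncomputable def jordanBlockFunction (f : ℝ → ℝ) (n : ℕ) (lam : ℝ) :
    Matrix (Fin n) (Fin n) ℝ :=
  Matrix.of fun i j =>
    if i ≤ j then
      iteratedDerivWithin ((j : ℕ) - (i : ℕ)) f (Set.Icc (-1) 1) lam /
        (Nat.factorial ((j : ℕ) - (i : ℕ)) : ℝ)
    else 0

/-- A Jordan decomposition `A = Z⁻¹ J Z` of a real matrix, where `J` is block diagonal with Jordan
blocks of positive sizes and real eigenvalues. The bijection `idx` places the blocks within the
index set `Fin k`; it may be any bijection, so placing the blocks one after the other along the
diagonal is a special case. -/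
structure JordanDecomposition {k : ℕ} (A : Matrix (Fin k) (Fin k) ℝ) where
  numBlocks : ℕ
  size : Fin numBlocks → ℕ
  size_pos : ∀ i, 0 < size i
  eigenvalue : Fin numBlocks → ℝ
  idx : (Σ i : Fin numBlocks, Fin (size i)) ≃ Fin k
  Z : Matrix (Fin k) (Fin k) ℝ
  isUnit_det : IsUnit Z.det
  eq_conj : A = Z⁻¹ *
    Matrix.reindex idx idx
      (Matrix.blockDiagonal' fun i => jordanBlock (size i) (eigenvalue i)) * Z

/-- The size of the largest Jordan block. -/
def JordanDecomposition.maxBlockSize {k : ℕ} {A : Matrix (Fin k) (Fin k) ℝ}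
    (D : JordanDecomposition A) : ℕ :=
  Finset.univ.sup D.size

/-- The matrix function `f(A) = Z⁻¹ f(J) Z`, where `f(J)` is block diagonal with blocks
`f(J_i)`. -/
noncomputable def JordanDecomposition.matrixFunction {k : ℕ} {A : Matrix (Fin k) (Fin k) ℝ}
    (D : JordanDecomposition A) (f : ℝ → ℝ) : Matrix (Fin k) (Fin k) ℝ :=
  D.Z⁻¹ *
    Matrix.reindex D.idx D.idx
      (Matrix.blockDiagonal' fun i => jordanBlockFunction f (D.size i) (D.eigenvalue i)) * D.Z

/-- `lam` is a semisimple eigenvalue of `A`: its algebraic multiplicity equals its geometric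
multiplicity. -/
def IsSemisimpleEigenvalue {k : ℕ} (A : Matrix (Fin k) (Fin k) ℝ) (lam : ℝ) : Prop :=
  Module.End.HasEigenvalue (Matrix.toLin' A) lam ∧
    A.charpoly.rootMultiplicity lam =
      Module.finrank ℝ (Module.End.eigenspace (Matrix.toLin' A) lam)

/-- `A` is a `δ`-condense matrix: a real matrix with real spectrum and spectral radius at most `1`,
all of whose eigenvalues in `[-1, -δ] ∪ [δ, 1]` are semisimple. -/
structure IsDeltaCondense {k : ℕ} (δ : ℝ) (A : Matrix (Fin k) (Fin k) ℝ) : Prop where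
  real_spectrum : A.charpoly.Splits
  spectralRadius_le_one : spectralRadius ℝ A ≤ 1
  semisimple : ∀ lam : ℝ, Module.End.HasEigenvalue (Matrix.toLin' A) lam →
    lam ∈ Set.Icc (-1) (-δ) ∪ Set.Icc δ 1 → IsSemisimpleEigenvalue A lam

/-- The quotient `ℝ[X] / ((X - lam)^e)` has a basis on which multiplication by `X` acts as a Jordan
block. -/
theorem exists_basis_quotient_jordan (lam : ℝ) (e : ℕ) :
    ∃ b : Module.Basis (Fin e) ℝ
        (Polynomial ℝ ⧸ Submodule.span (Polynomial ℝ) {(Polynomial.X - Polynomial.C lam) ^ e}),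
      ∀ s : Fin e, (Polynomial.X : Polynomial ℝ) • b s =
        ∑ r : Fin e, jordanBlock e lam r s • b r := by
  classical
  set g : Polynomial ℝ := Polynomial.X - Polynomial.C lam with hg
  have hmon : (g ^ e).Monic := (Polynomial.monic_X_sub_C lam).pow e
  have hdeg : (g ^ e).natDegree = e := by simp [hg]
  have hgdeg : ∀ a : ℕ, (g ^ a).natDegree = a := fun a => by simp [hg]
  let Q := Polynomial ℝ ⧸ Submodule.span (Polynomial ℝ) {g ^ e}
  let v : Fin e → Q := fun j => Submodule.Quotient.mk (g ^ (e - 1 - (j : ℕ)))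
  have hfin : Module.finrank ℝ Q = e := by
    have := (AdjoinRoot.powerBasis' hmon).finrank
    rw [AdjoinRoot.powerBasis'_dim, hdeg] at this
    exact this
  have hli : LinearIndependent ℝ v := by
    rw [Fintype.linearIndependent_iff]
    intro c hc
    have h1 : (Submodule.Quotient.mk (∑ j : Fin e, c j • g ^ (e - 1 - (j : ℕ))) : Q) = 0 := by
      rw [← hc]
      simp only [v]
      exact map_sum ((Submodule.mkQ (Submodule.span (Polynomial ℝ) {g ^ e})).restrictScalars ℝ) _ _
        |>.trans (Finset.sum_congr rfl fun j _ => map_smul _ _ _)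
    rw [Submodule.Quotient.mk_eq_zero, Submodule.mem_span_singleton] at h1
    obtain ⟨q, hq⟩ := h1
    have h2 : ∑ j : Fin e, c j • g ^ (e - 1 - (j : ℕ)) = 0 := by
      by_contra hne
      have hd : g ^ e ∣ ∑ j : Fin e, c j • g ^ (e - 1 - (j : ℕ)) := ⟨q, by rw [← hq]; simp [mul_comm]⟩
      have h3 := Polynomial.natDegree_le_of_dvd hd hne
      rw [hdeg] at h3
      have h4 : (∑ j : Fin e, c j • g ^ (e - 1 - (j : ℕ))).natDegree ≤ e - 1 :=
        Polynomial.natDegree_sum_le_of_forall_le _ _ fun j _ =>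
          (Polynomial.natDegree_smul_le _ _).trans (by rw [hgdeg]; omega)
      have h5 : 0 < e := by
        rcases Nat.eq_zero_or_pos e with h | h
        · subst h; simp at hne
        · exact h
      omega
    have h6 := congrArg (fun p : Polynomial ℝ => p.comp (Polynomial.X + Polynomial.C lam)) h2
    simp only [Polynomial.sum_comp, Polynomial.smul_comp, Polynomial.pow_comp, hg,
      Polynomial.sub_comp, Polynomial.X_comp, Polynomial.C_comp, add_sub_cancel_right,
      Polynomial.zero_comp] at h6
    intro i
    have h7 := congrArg (fun p : Polynomial ℝ => p.coeff (e - 1 - (i : ℕ))) h6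
    simp only [Polynomial.finsetSum_coeff, Polynomial.coeff_smul, Polynomial.coeff_X_pow,
      Polynomial.coeff_zero] at h7
    rw [Finset.sum_eq_single i] at h7
    · simpa using h7
    · intro j _ hj
      rw [if_neg]
      · simp
      · intro h; apply hj; ext; omega
    · simp
  have hcard : Fintype.card (Fin e) = Module.finrank ℝ Q := by rw [hfin]; simp
  rcases Nat.eq_zero_or_pos e with he | he
  · subst he
    have : Module.Finite ℝ Q := Module.Finite.of_basis (AdjoinRoot.powerBasis' hmon).basis
    exact ⟨Module.finBasisOfFinrankEq ℝ Q hfin, fun s => s.elim0⟩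
  have : Nonempty (Fin e) := ⟨⟨0, he⟩⟩
  refine ⟨basisOfLinearIndependentOfCardEqFinrank hli hcard, fun s => ?_⟩
  simp only [coe_basisOfLinearIndependentOfCardEqFinrank]
  have hX : (Polynomial.X : Polynomial ℝ) = Polynomial.C lam + g := by rw [hg]; ring
  have hlam : (Polynomial.C lam : Polynomial ℝ) • v s = lam • v s := by
    rw [← algebraMap_smul (Polynomial ℝ) lam (v s)]; rfl
  rw [hX, add_smul, hlam]
  have hgs : g • v s = (Submodule.Quotient.mk (g ^ (e - 1 - (s : ℕ) + 1)) : Q) := by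
    simp only [v]
    rw [← Submodule.Quotient.mk_smul, smul_eq_mul, pow_succ']
  rw [hgs]
  by_cases hs : (s : ℕ) = 0
  · have h0 : (Submodule.Quotient.mk (g ^ (e - 1 - (s : ℕ) + 1)) : Q) = 0 := by
      rw [Submodule.Quotient.mk_eq_zero, show e - 1 - (s : ℕ) + 1 = e by omega]
      exact Submodule.mem_span_singleton_self _
    rw [h0, add_zero, Finset.sum_eq_single s]
    · simp [jordanBlock]
    · intro r _ hr
      have : ¬ ((r : ℕ) + 1 = (s : ℕ)) := by omega
      simp [jordanBlock, hr, this]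
    · simp
  · let t : Fin e := ⟨(s : ℕ) - 1, by omega⟩
    have hts : t ≠ s := by intro h; have := congrArg Fin.val h; simp [t] at this; omega
    have h0 : (Submodule.Quotient.mk (g ^ (e - 1 - (s : ℕ) + 1)) : Q) = v t := by
      simp only [v, t]
      rw [show e - 1 - (s : ℕ) + 1 = e - 1 - ((s : ℕ) - 1) by omega]
    rw [h0, Fintype.sum_eq_add s t hts.symm]
    · have : (t : ℕ) + 1 = s := by simp [t]; omega
      simp [jordanBlock, hts, this]
    · rintro r ⟨hr, hr'⟩
      have : ¬ ((r : ℕ) + 1 = (s : ℕ)) := by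
        intro h; apply hr'; ext; simp [t]; omega
      simp [jordanBlock, hr, this]

/-- Every real matrix with real spectrum has a Jordan decomposition. -/
theorem JordanDecomposition.nonempty_of_splits {k : ℕ} (A : Matrix (Fin k) (Fin k) ℝ)
    (hA : A.charpoly.Splits) : Nonempty (JordanDecomposition A) := by
  classical
  let φ : Module.End ℝ (Fin k → ℝ) := Matrix.toLin' A
  let M := Module.AEval' φ
  have hann : ∀ x : M, A.charpoly • x = 0 := by
    intro x
    obtain ⟨y, rfl⟩ := (Module.AEval'.of φ).surjective x
    have h0 : Polynomial.aeval φ A.charpoly = 0 := by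
      have := LinearMap.aeval_self_charpoly φ
      rwa [show φ.charpoly = A.charpoly from Matrix.charpoly_toLin' A] at this
    have := Module.AEval.of_aeval_smul (R := ℝ) (M := Fin k → ℝ) φ A.charpoly y
    rw [h0] at this
    exact this.symm.trans (by simp)
  have hne : A.charpoly ≠ 0 := A.charpoly_monic.ne_zero
  have htors : Module.IsTorsion (Polynomial ℝ) M := fun x =>
    ⟨⟨A.charpoly, mem_nonZeroDivisors_of_ne_zero hne⟩, hann x⟩
  obtain ⟨ι, hι, p, hp, e, ⟨E⟩⟩ := Module.equiv_directSum_of_isTorsion htors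
  have hroot : ∀ i : ι, 0 < e i → ∃ lam : ℝ,
      Submodule.span (Polynomial ℝ) {p i ^ e i} =
        Submodule.span (Polynomial ℝ) {(Polynomial.X - Polynomial.C lam) ^ e i} := by
    intro i hi
    have h1 : A.charpoly • (DirectSum.lof (Polynomial ℝ) ι
        (fun i => Polynomial ℝ ⧸ Submodule.span (Polynomial ℝ) {p i ^ e i}) i
          (Submodule.Quotient.mk 1)) = 0 := by
      rw [← E.apply_symm_apply (DirectSum.lof _ _ _ _ _), ← map_smul, hann, map_zero]
    rw [← map_smul, ← Submodule.Quotient.mk_smul] at h1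
    have h2 := congrArg (fun z => z i) h1
    simp only [DirectSum.lof_apply] at h2
    rw [DirectSum.zero_apply, Submodule.Quotient.mk_eq_zero, Submodule.mem_span_singleton] at h2
    obtain ⟨q, hq⟩ := h2
    have hdvd : p i ∣ A.charpoly := by
      have : p i ^ e i ∣ A.charpoly := ⟨q, by simpa [mul_comm] using hq.symm⟩
      exact (dvd_pow_self _ hi.ne').trans this
    have hd : (p i).degree = 1 :=
      (hA.of_dvd hne hdvd).degree_eq_one_of_irreducible (hp i)
    obtain ⟨lam, hlam⟩ := Polynomial.exists_root_of_degree_eq_one hd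
    refine ⟨lam, ?_⟩
    have hassoc : Associated (p i) (Polynomial.X - Polynomial.C lam) :=
      ((Polynomial.irreducible_X_sub_C lam).associated_of_dvd (hp i)
        (Polynomial.dvd_iff_isRoot.2 hlam)).symm
    exact Ideal.span_singleton_eq_span_singleton.2 (hassoc.pow_pow)
  have hbasis : ∀ i : ι, ∃ (lam : ℝ) (b : Module.Basis (Fin (e i)) ℝ
        (Polynomial ℝ ⧸ Submodule.span (Polynomial ℝ) {p i ^ e i})),
      ∀ s : Fin (e i), (Polynomial.X : Polynomial ℝ) • b s =
        ∑ r : Fin (e i), jordanBlock (e i) lam r s • b r := by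
    intro i
    rcases Nat.eq_zero_or_pos (e i) with h0 | hpos
    · have hspan : Submodule.span (Polynomial ℝ) {p i ^ e i} =
          Submodule.span (Polynomial ℝ) {(Polynomial.X - Polynomial.C (0 : ℝ)) ^ e i} := by
        rw [h0, pow_zero, pow_zero]
      rw [hspan]
      exact ⟨0, exists_basis_quotient_jordan 0 (e i)⟩
    · obtain ⟨lam, h⟩ := hroot i hpos
      rw [h]
      exact ⟨lam, exists_basis_quotient_jordan lam (e i)⟩
  choose lam b hb using hbasis
  let F : (Fin k → ℝ) ≃ₗ[ℝ]
      ((i : ι) → Polynomial ℝ ⧸ Submodule.span (Polynomial ℝ) {p i ^ e i}) :=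
    (Module.AEval'.of φ).trans ((E.trans
      (DirectSum.linearEquivFunOnFintype (Polynomial ℝ) ι _)).restrictScalars ℝ)
  have hF : ∀ y, F (φ y) = (Polynomial.X : Polynomial ℝ) • F y := by
    intro y
    change (E.trans (DirectSum.linearEquivFunOnFintype (Polynomial ℝ) ι _))
      (Module.AEval'.of φ (φ y)) = _
    rw [← Module.AEval'.X_smul_of, map_smul]
    rfl
  let B : Module.Basis (Σ i : ι, Fin (e i)) ℝ (Fin k → ℝ) := (Pi.basis b).map F.symm
  have hB : ∀ (i : ι) (s : Fin (e i)), φ (B ⟨i, s⟩) =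
      ∑ r : Fin (e i), jordanBlock (e i) (lam i) r s • B ⟨i, r⟩ := by
    intro i s
    apply F.injective
    rw [hF, map_sum]
    simp only [B, Module.Basis.map_apply, LinearEquiv.apply_symm_apply, map_smul, Pi.basis_apply]
    rw [← Pi.single_smul, hb]
    exact (map_sum (LinearMap.single ℝ _ i) _ _).trans (Finset.sum_congr rfl fun r _ => by
      rw [map_smul]; rfl)
  -- discard the trivial summands and renumber
  let ι' := {i : ι // 0 < e i}
  let n := Fintype.card ι'
  let σ : ι' ≃ Fin n := Fintype.equivFin ι'
  let τ : (Σ i : ι, Fin (e i)) ≃ (Σ i : Fin n, Fin (e (σ.symm i).1)) :=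
    { toFun := fun x => ⟨σ ⟨x.1, x.2.pos⟩, ⟨x.2.1, by simp⟩⟩
      invFun := fun x => ⟨(σ.symm x.1).1, x.2⟩
      left_inv := by
        rintro ⟨i, s⟩
        have h : σ.symm (σ ⟨i, s.pos⟩) = ⟨i, s.pos⟩ := by simp
        apply Sigma.ext
        · simp
        · simp only
          refine (Fin.heq_ext_iff (by simp)).2 rfl
      right_inv := by
        rintro ⟨i, s⟩
        apply Sigma.ext
        · simp
        · simp only
          refine (Fin.heq_ext_iff (by simp)).2 rfl }
  let B' : Module.Basis (Σ i : Fin n, Fin (e (σ.symm i).1)) ℝ (Fin k → ℝ) := B.reindex τ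
  have hB' : ∀ (i : Fin n) (s : Fin (e (σ.symm i).1)), φ (B' ⟨i, s⟩) =
      ∑ r, jordanBlock (e (σ.symm i).1) (lam (σ.symm i).1) r s • B' ⟨i, r⟩ := by
    intro i s
    simp only [B', Module.Basis.reindex_apply]
    exact hB _ s
  have hcard : Fintype.card (Σ i : Fin n, Fin (e (σ.symm i).1)) = Fintype.card (Fin k) := by
    rw [← Module.finrank_eq_card_basis B', Module.finrank_fintype_fun_eq_card]
  let idx : (Σ i : Fin n, Fin (e (σ.symm i).1)) ≃ Fin k := Fintype.equivOfCardEq hcard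
  let B'' : Module.Basis (Fin k) ℝ (Fin k → ℝ) := B'.reindex idx
  let c : Module.Basis (Fin k) ℝ (Fin k → ℝ) := Pi.basisFun ℝ (Fin k)
  have hJ : LinearMap.toMatrix B'' B'' φ = Matrix.reindex idx idx
      (Matrix.blockDiagonal' fun i =>
        jordanBlock (e (σ.symm i).1) (lam (σ.symm i).1)) := by
    ext a d
    obtain ⟨⟨i, r⟩, rfl⟩ := idx.surjective a
    obtain ⟨⟨j, s⟩, rfl⟩ := idx.surjective d
    rw [LinearMap.toMatrix_apply]
    simp only [B'', Module.Basis.reindex_apply, Equiv.symm_apply_apply,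
      Module.Basis.repr_reindex_apply, Matrix.reindex_apply, Matrix.submatrix_apply]
    rw [hB', map_sum, Finsupp.finsetSum_apply]
    simp only [map_smul, Module.Basis.repr_self, Finsupp.smul_apply, smul_eq_mul,
      Finsupp.single_apply]
    by_cases hij : i = j
    · subst hij
      rw [Matrix.blockDiagonal'_apply_eq]
      simp
    · rw [Matrix.blockDiagonal'_apply_ne _ _ _ hij]
      apply Finset.sum_eq_zero
      intro t _
      rw [if_neg]
      · simp
      · intro h
        exact hij (congrArg Sigma.fst h).symm
  have hinv : B''.toMatrix c * c.toMatrix B'' = 1 := B''.toMatrix_mul_toMatrix_flip c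
  have hinv' : c.toMatrix B'' * B''.toMatrix c = 1 := c.toMatrix_mul_toMatrix_flip B''
  refine ⟨⟨n, fun i => e (σ.symm i).1, fun i => (σ.symm i).2, fun i => lam (σ.symm i).1, idx,
    B''.toMatrix c, ?_, ?_⟩⟩
  · exact (Matrix.isUnit_iff_isUnit_det _).1 ⟨⟨_, _, hinv, hinv'⟩, rfl⟩
  · rw [Matrix.inv_eq_right_inv hinv, ← hJ,
      basis_toMatrix_mul_linearMap_toMatrix_mul_basis_toMatrix]
    exact (LinearMap.toMatrix'_toLin' A).symm

/-! The substitution t = cos θ turns Chebyshev coefficients into cosine coefficients. A function of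
bounded variation has cosine coefficients O(1/n), and each integration by parts gains another factor
1/n (`cosCoeff_succ_of_ae_hasDerivAt`). With m+ℓ derivatives, the last of bounded variation, the
coefficients of f are O(n^{-(m+ℓ+1)}).

On |x| ≤ δ < 1 the s-th derivative of T_n is O(n^s), by the Chebyshev differential equation. Near ±1
it can grow like n^{2s}, and this is what the condensed spectrum avoids. Hence for s < m the s-th
derivative of the series has terms O(n^{-(ℓ+2)}) on (-δ, δ) and tail O(N^{-(ℓ+1)}); for s = 0 the
bound |T_n| ≤ 1 gives this on all of [-1, 1] (`exists_chebyshev_error_le`).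

The partial sum is a polynomial P evaluated at A, so P(A) - f(A) is conjugate to a block diagonal
matrix with entries (P - f)^{(s)}(λ)/s! (`aeval_jordanBlock_apply`). Blocks have size at most m, so
s < m. An eigenvalue outside (-δ, δ) is semisimple, its blocks have size one
(`size_eq_one_of_isSemisimple`), and only s = 0 occurs. Expanding in matrix units converts the
entrywise estimate into one for the norm (`norm_conjBlocks_le`). -/

/-! ### Decay of the Chebyshev coefficients. -/

/-- The integral `∫_0^π g(cos θ) cos(nθ) dθ`. -/
noncomputable def cosCoeff (g : ℝ → ℝ) (n : ℕ) : ℝ :=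
  ∫ θ in (0 : ℝ)..Real.pi, g (Real.cos θ) * Real.cos (n * θ)

theorem chebyshevCoeff_eq_cosCoeff (f : ℝ → ℝ) (n : ℕ) :
    chebyshevCoeff f n = 2 / Real.pi * cosCoeff f n := by
  have h := (Polynomial.Chebyshev.integral_measureT
    (fun t => f t * (Polynomial.Chebyshev.T ℝ (n : ℤ)).eval t)).symm.trans
      Polynomial.Chebyshev.integral_measureT_eq_integral_cos
  simp only [Polynomial.Chebyshev.T_real_cos, Int.cast_natCast, Real.sqrt_inv,
    ← div_eq_mul_inv] at h
  rw [chebyshevCoeff, cosCoeff, h]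

/-- An absolutely continuous function is the integral of its derivative, which is bounded here. The
Lipschitz property passes directly to the composition with cos, where the integration by parts takes
place. -/
theorem lipschitzOnWith_of_ae_hasDerivAt {G h : ℝ → ℝ} {a b M : ℝ} (hab : a ≤ b)
    (hG : AbsolutelyContinuousOnInterval G a b)
    (hM : ∀ x ∈ Set.Icc a b, |h x| ≤ M)
    (hderiv : ∀ᵐ x ∂(MeasureTheory.volume.restrict (Set.Icc a b)), HasDerivAt G (h x) x) :
    LipschitzOnWith M.toNNReal G (Set.Icc a b) := by
  have hM0 : 0 ≤ M := (abs_nonneg _).trans (hM a (Set.left_mem_Icc.2 hab))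
  refine LipschitzOnWith.of_dist_le_mul fun x hx y hy => ?_
  have hsub : Set.uIcc y x ⊆ Set.Icc a b := Set.uIcc_subset_Icc hy hx
  have hac : AbsolutelyContinuousOnInterval G y x :=
    hG.mono (by rwa [Set.uIcc_of_le hab])
  rw [Real.dist_eq, ← hac.integral_deriv_eq_sub, Real.coe_toNNReal _ hM0, Real.dist_eq,
    ← Real.norm_eq_abs]
  refine intervalIntegral.norm_integral_le_of_norm_le_const_ae ?_
  rw [MeasureTheory.ae_restrict_iff' measurableSet_Icc] at hderiv
  filter_upwards [hderiv] with t ht htm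
  have hmem := hsub (Set.uIoc_subset_uIcc htm)
  rw [(ht hmem).deriv, Real.norm_eq_abs]
  exact hM t hmem

/-- The exceptional angles in (0, π) are the image of a null set under arccos, which is
differentiable on (-1, 1) and so maps null sets to null sets. -/
theorem ae_comp_cos {p : ℝ → Prop}
    (hp : ∀ᵐ x ∂(MeasureTheory.volume.restrict (Set.Icc (-1 : ℝ) 1)), p x) :
    ∀ᵐ θ : ℝ, θ ∈ Set.uIoc 0 Real.pi → p (Real.cos θ) := by
  rw [MeasureTheory.ae_restrict_iff' measurableSet_Icc, MeasureTheory.ae_iff] at hp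
  have hnull : MeasureTheory.volume
      (Real.arccos '' ({x | ¬(x ∈ Set.Icc (-1 : ℝ) 1 → p x)} ∩ Set.Ioo (-1) 1)) = 0 := by
    refine MeasureTheory.addHaar_image_eq_zero_of_differentiableOn_of_addHaar_eq_zero _ ?_
      (MeasureTheory.measure_mono_null Set.inter_subset_left hp)
    intro x hx
    exact (Real.differentiableAt_arccos.2 ⟨hx.2.1.ne', hx.2.2.ne⟩).differentiableWithinAt
  have hpi : ∀ᵐ θ : ℝ, θ ≠ Real.pi := by simp [MeasureTheory.ae_iff]
  filter_upwards [MeasureTheory.compl_mem_ae_iff.2 hnull, hpi] with θ hθ hθpi hmem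
  rw [Set.uIoc_of_le Real.pi_pos.le] at hmem
  by_contra hcon
  have hlt : θ < Real.pi := lt_of_le_of_ne hmem.2 hθpi
  refine hθ ⟨Real.cos θ, ⟨fun h => hcon (h (Real.cos_mem_Icc θ)), ?_, ?_⟩,
    Real.arccos_cos hmem.1.le hmem.2⟩
  · rw [← Real.cos_pi]
    exact Real.strictAntiOn_cos ⟨hmem.1.le, hmem.2⟩ ⟨Real.pi_pos.le, le_rfl⟩ hlt
  · rw [← Real.cos_zero]
    exact Real.strictAntiOn_cos ⟨le_rfl, Real.pi_pos.le⟩ ⟨hmem.1.le, hmem.2⟩ hmem.1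

/-- Integration by parts relates the coefficients of `G` to those of its derivative `h`. -/
theorem cosCoeff_succ_of_ae_hasDerivAt {G h : ℝ → ℝ} {K : NNReal}
    (hG : LipschitzOnWith K G (Set.Icc (-1) 1))
    (hh : IntervalIntegrable (fun θ => h (Real.cos θ)) MeasureTheory.volume 0 Real.pi)
    (hderiv : ∀ᵐ x ∂(MeasureTheory.volume.restrict (Set.Icc (-1 : ℝ) 1)), HasDerivAt G (h x) x)
    (n : ℕ) :
    cosCoeff G (n + 1) = (cosCoeff h n - cosCoeff h (n + 2)) / (2 * (n + 1)) := by
  have hn : ((n : ℝ) + 1) ≠ 0 := by positivity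
  have hGc : AbsolutelyContinuousOnInterval (fun θ => G (Real.cos θ)) 0 Real.pi := by
    have : LipschitzOnWith (K * 1) (fun θ => G (Real.cos θ)) (Set.uIcc 0 Real.pi) :=
      hG.comp Real.lipschitzWith_cos.lipschitzOnWith fun θ _ => Real.cos_mem_Icc θ
    exact this.absolutelyContinuousOnInterval
  have hS : ∀ θ : ℝ, HasDerivAt (fun θ => Real.sin ((n + 1) * θ) / (n + 1))
      (Real.cos ((n + 1) * θ)) θ := by
    intro θ
    have := (((hasDerivAt_id θ).const_mul ((n : ℝ) + 1)).sin).div_const ((n : ℝ) + 1)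
    simpa [mul_div_cancel_right₀ _ hn] using this
  have hSac : AbsolutelyContinuousOnInterval
      (fun θ => Real.sin ((n + 1) * θ) / (n + 1)) 0 Real.pi :=
    ContDiffOn.absolutelyContinuousOnInterval (by fun_prop)
  have hparts := hGc.integral_mul_deriv_eq_deriv_mul hSac
  have hsin : Real.sin (((n : ℝ) + 1) * Real.pi) = 0 := by
    exact_mod_cast Real.sin_nat_mul_pi (n + 1)
  simp only [(hS _).deriv, hsin, mul_zero, Real.sin_zero, zero_div, sub_zero, zero_sub] at hparts
  have hder : ∫ θ in (0 : ℝ)..Real.pi, deriv (fun θ => G (Real.cos θ)) θ *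
      (Real.sin ((n + 1) * θ) / (n + 1)) =
      ∫ θ in (0 : ℝ)..Real.pi, (1 / (2 * ((n : ℝ) + 1))) *
        (h (Real.cos θ) * Real.cos ((n + 2) * θ) - h (Real.cos θ) * Real.cos (n * θ)) := by
    refine intervalIntegral.integral_congr_ae ?_
    filter_upwards [ae_comp_cos hderiv] with θ hθ hmem
    have := (hθ hmem).comp θ (Real.hasDerivAt_cos θ)
    rw [show deriv (fun θ => G (Real.cos θ)) θ = h (Real.cos θ) * -Real.sin θ from this.deriv]
    -- The boundary terms vanish because sin((n+1)θ) is zero at 0 and π. What remains is -sin θ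
    -- sin((n+1)θ) = (cos((n+2)θ) - cos(nθ))/2.
    have h1 : ((n : ℝ) + 2) * θ = (n + 1) * θ + θ := by ring
    have h2 : (n : ℝ) * θ = (n + 1) * θ - θ := by ring
    rw [h1, h2, Real.cos_add, Real.cos_sub]
    field_simp
    ring
  have hint : ∀ c : ℝ, IntervalIntegrable (fun θ => h (Real.cos θ) * Real.cos (c * θ))
      MeasureTheory.volume 0 Real.pi := fun c => hh.mul_continuousOn (by fun_prop)
  rw [hder, intervalIntegral.integral_const_mul,
    intervalIntegral.integral_sub (hint _) (hint _)] at hparts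
  simp only [cosCoeff]
  push_cast
  rw [hparts]
  ring

/-- A shift by the half period s = π/n changes the sign of cos(nθ). Adding the integral to its
shifted form gives twice its value as two end pieces, each at most Ms, plus the integral of (u(θ) -
u(θ+s)) cos(nθ). By monotonicity the latter is at most ∫ (u(θ+s) - u(θ)), which telescopes to two
integrals over intervals of length s. In total 4Ms, that is 2Ms for the integral itself. -/
theorem abs_integral_monotoneOn_mul_cos_le {u : ℝ → ℝ} {M : ℝ}
    (hu : MonotoneOn u (Set.Icc 0 Real.pi)) (hM : ∀ x ∈ Set.Icc 0 Real.pi, |u x| ≤ M)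
    {n : ℕ} (hn : 1 ≤ n) :
    |∫ θ in (0 : ℝ)..Real.pi, u θ * Real.cos (n * θ)| ≤ 2 * Real.pi * M / n := by
  have hn0 : (0 : ℝ) < n := by exact_mod_cast hn
  set s : ℝ := Real.pi / n with hs
  have hs0 : 0 < s := div_pos Real.pi_pos hn0
  have hsp : s ≤ Real.pi := div_le_self Real.pi_pos.le (by exact_mod_cast hn)
  have hint : ∀ {a b : ℝ}, 0 ≤ a → a ≤ Real.pi → 0 ≤ b → b ≤ Real.pi →
      IntervalIntegrable u MeasureTheory.volume a b := fun ha ha' hb hb' =>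
    (hu.mono (Set.uIcc_subset_Icc ⟨ha, ha'⟩ ⟨hb, hb'⟩)).intervalIntegrable
  have hshift : IntervalIntegrable (fun θ => u (θ + s)) MeasureTheory.volume 0 (Real.pi - s) := by
    have := (hint hs0.le hsp Real.pi_pos.le le_rfl).comp_add_right s
    simpa using this
  have hcs : ∀ {v : ℝ → ℝ} {a b : ℝ}, IntervalIntegrable v MeasureTheory.volume a b →
      IntervalIntegrable (fun θ => v θ * Real.cos (n * θ)) MeasureTheory.volume a b :=
    fun hv => hv.mul_continuousOn (by fun_prop)
  have h1 : ∫ θ in s..Real.pi, u θ * Real.cos (n * θ) =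
      -∫ θ in (0 : ℝ)..(Real.pi - s), u (θ + s) * Real.cos (n * θ) := by
    have := intervalIntegral.integral_comp_add_right (a := 0) (b := Real.pi - s)
      (fun θ => u θ * Real.cos (n * θ)) s
    rw [zero_add, sub_add_cancel] at this
    rw [← this, ← intervalIntegral.integral_neg]
    refine intervalIntegral.integral_congr fun θ _ => ?_
    have : (n : ℝ) * (θ + s) = n * θ + Real.pi := by rw [hs]; field_simp
    simp only [this, Real.cos_add_pi]
    ring
  have hsmall : ∀ {a b : ℝ}, 0 ≤ a → a ≤ b → b ≤ Real.pi →
      |∫ θ in a..b, u θ * Real.cos (n * θ)| ≤ M * (b - a) := by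
    intro a b ha hab hb
    have := intervalIntegral.norm_integral_le_of_norm_le_const (a := a) (b := b) (C := M)
      (f := fun θ => u θ * Real.cos (n * θ)) ?_
    · rwa [abs_of_nonneg (sub_nonneg.2 hab)] at this
    · intro x hx
      rw [Set.uIoc_of_le hab] at hx
      rw [norm_mul, Real.norm_eq_abs, Real.norm_eq_abs]
      have hx' := hM x ⟨ha.trans hx.1.le, hx.2.trans hb⟩
      calc |u x| * |Real.cos (n * x)| ≤ M * 1 :=
            mul_le_mul hx' (Real.abs_cos_le_one _) (abs_nonneg _) ((abs_nonneg _).trans hx')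
        _ = M := mul_one M
  have hsmall' : ∀ {a b : ℝ}, 0 ≤ a → a ≤ b → b ≤ Real.pi →
      |∫ θ in a..b, u θ| ≤ M * (b - a) := by
    intro a b ha hab hb
    have := intervalIntegral.norm_integral_le_of_norm_le_const (a := a) (b := b) (C := M)
      (f := u) ?_
    · rwa [abs_of_nonneg (sub_nonneg.2 hab)] at this
    · intro x hx
      rw [Set.uIoc_of_le hab] at hx
      exact hM x ⟨ha.trans hx.1.le, hx.2.trans hb⟩
  have h2 : |∫ θ in (0 : ℝ)..(Real.pi - s), (u θ - u (θ + s)) * Real.cos (n * θ)| ≤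
      2 * M * s := by
    have hb := intervalIntegral.norm_integral_le_of_norm_le
      (f := fun θ => (u θ - u (θ + s)) * Real.cos (n * θ)) (g := fun θ => u (θ + s) - u θ)
      (a := 0) (b := Real.pi - s) (μ := MeasureTheory.volume) (by linarith) ?_ ?_
    · refine hb.trans ?_
      have h0 := hint (a := 0) (b := Real.pi - s) le_rfl Real.pi_pos.le (by linarith) (by linarith)
      rw [intervalIntegral.integral_sub hshift h0,
        intervalIntegral.integral_comp_add_right, zero_add, sub_add_cancel]
      have e1 := intervalIntegral.integral_add_adjacent_intervals (hint (a := 0) (b := s) le_rfl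
        Real.pi_pos.le hs0.le hsp) (hint hs0.le hsp Real.pi_pos.le le_rfl)
      have e2 := intervalIntegral.integral_add_adjacent_intervals h0
        (hint (a := Real.pi - s) (b := Real.pi) (by linarith) (by linarith) Real.pi_pos.le le_rfl)
      have b1 := abs_le.1 (hsmall' (a := 0) (b := s) le_rfl hs0.le hsp)
      have b2 := abs_le.1 (hsmall' (a := Real.pi - s) (b := Real.pi) (by linarith)
        (by linarith) le_rfl)
      have e3 : M * (Real.pi - (Real.pi - s)) = M * s := by ring
      have e4 : M * (s - 0) = M * s := by ring
      rw [e3] at b2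
      rw [e4] at b1
      linarith [b1.1, b1.2, b2.1, b2.2]
    · refine Filter.Eventually.of_forall fun x hx => ?_
      have hle : u x ≤ u (x + s) := hu ⟨hx.1.le, by linarith [hx.2]⟩
        ⟨by linarith [hx.1], by linarith [hx.2]⟩ (by linarith)
      rw [norm_mul, Real.norm_eq_abs, Real.norm_eq_abs, abs_sub_comm,
        abs_of_nonneg (sub_nonneg.2 hle)]
      exact mul_le_of_le_one_right (sub_nonneg.2 hle) (Real.abs_cos_le_one _)
    · exact hshift.sub (hint le_rfl Real.pi_pos.le (by linarith) (by linarith))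
  have h0 := hint (a := 0) (b := Real.pi - s) le_rfl Real.pi_pos.le (by linarith) (by linarith)
  have e1 := intervalIntegral.integral_add_adjacent_intervals (hcs (hint (a := 0) (b := s) le_rfl
        Real.pi_pos.le hs0.le hsp)) (hcs (hint hs0.le hsp Real.pi_pos.le le_rfl))
  have e2 := intervalIntegral.integral_add_adjacent_intervals (hcs h0)
        (hcs (hint (a := Real.pi - s) (b := Real.pi) (by linarith) (by linarith)
          Real.pi_pos.le le_rfl))
  have e3 := intervalIntegral.integral_sub (hcs h0) (hcs hshift)
  simp only [← sub_mul] at e3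
  rw [e3] at h2
  rw [h1] at e1
  have b1 := abs_le.1 (hsmall (a := 0) (b := s) le_rfl hs0.le hsp)
  have b2 := abs_le.1 (hsmall (a := Real.pi - s) (b := Real.pi) (by linarith)
        (by linarith) le_rfl)
  have b3 := abs_le.1 h2
  have e5 : M * (Real.pi - (Real.pi - s)) = M * s := by ring
  have e6 : M * (s - 0) = M * s := by ring
  rw [e5] at b2
  rw [e6] at b1
  have e7 : 2 * Real.pi * M / n = 2 * (M * s) := by rw [hs]; ring
  rw [e7, abs_le]
  constructor <;> linarith [b1.1, b1.2, b2.1, b2.2, b3.1, b3.2]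

/-- A function of bounded variation on `[-1, 1]` is, after composition with `cos`, a difference of
two monotone functions on `[0, π]`. -/
theorem BoundedVariationOn.exists_monotoneOn_sub_comp_cos {h : ℝ → ℝ}
    (hh : BoundedVariationOn h (Set.Icc (-1) 1)) :
    ∃ u v : ℝ → ℝ, MonotoneOn u (Set.Icc 0 Real.pi) ∧ MonotoneOn v (Set.Icc 0 Real.pi) ∧
      ∀ θ, h (Real.cos θ) = u θ - v θ := by
  obtain ⟨p, q, hp, hq, rfl⟩ :=
    hh.locallyBoundedVariationOn.exists_monotoneOn_sub_monotoneOn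
  have key : ∀ {w : ℝ → ℝ}, MonotoneOn w (Set.Icc (-1) 1) →
      MonotoneOn (fun θ => -w (Real.cos θ)) (Set.Icc 0 Real.pi) := fun hw x hx y hy hxy =>
    neg_le_neg (hw (Real.cos_mem_Icc y) (Real.cos_mem_Icc x)
      (Real.strictAntiOn_cos.antitoneOn hx hy hxy))
  -- Since cos is decreasing on [0, π], the negatives are monotone and the two functions change
  -- roles.
  exact ⟨_, _, key hq, key hp, fun θ => by simp [sub_eq_add_neg, add_comm]⟩

theorem MonotoneOn.exists_abs_le_Icc {u : ℝ → ℝ} {a b : ℝ} (hu : MonotoneOn u (Set.Icc a b)) :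
    ∃ M, ∀ x ∈ Set.Icc a b, |u x| ≤ M := by
  refine ⟨max |u a| |u b|, fun x hx => abs_le_max_abs_abs ?_ ?_⟩
  · exact hu ⟨le_rfl, hx.1.trans hx.2⟩ hx hx.1
  · exact hu hx ⟨hx.1.trans hx.2, le_rfl⟩ hx.2

theorem BoundedVariationOn.intervalIntegrable_comp_cos {h : ℝ → ℝ}
    (hh : BoundedVariationOn h (Set.Icc (-1) 1)) :
    IntervalIntegrable (fun θ => h (Real.cos θ)) MeasureTheory.volume 0 Real.pi := by
  obtain ⟨u, v, hu, hv, huv⟩ := hh.exists_monotoneOn_sub_comp_cos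
  rw [← Set.uIcc_of_le Real.pi_pos.le] at hu hv
  simp only [huv]
  exact hu.intervalIntegrable.sub hv.intervalIntegrable

/-- The exponent is written as `1` to match `r = 1` in `exists_abs_cosCoeff_le_succ`, where the
induction on derivatives starts. -/
theorem BoundedVariationOn.exists_abs_cosCoeff_le {h : ℝ → ℝ}
    (hh : BoundedVariationOn h (Set.Icc (-1) 1)) :
    ∃ C, ∀ n : ℕ, 1 ≤ n → |cosCoeff h n| ≤ C / (n : ℝ) ^ 1 := by
  obtain ⟨u, v, hu, hv, huv⟩ := hh.exists_monotoneOn_sub_comp_cos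
  obtain ⟨M, hM⟩ := hu.exists_abs_le_Icc
  obtain ⟨M', hM'⟩ := hv.exists_abs_le_Icc
  refine ⟨2 * Real.pi * M + 2 * Real.pi * M', fun n hn => ?_⟩
  have hi : ∀ {w : ℝ → ℝ}, MonotoneOn w (Set.Icc 0 Real.pi) →
      IntervalIntegrable (fun θ => w θ * Real.cos (n * θ)) MeasureTheory.volume 0 Real.pi := by
    intro w hw
    rw [← Set.uIcc_of_le Real.pi_pos.le] at hw
    exact hw.intervalIntegrable.mul_continuousOn (by fun_prop)
  simp only [cosCoeff, huv, sub_mul]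
  rw [intervalIntegral.integral_sub (hi hu) (hi hv), pow_one, add_div]
  exact (abs_sub _ _).trans (add_le_add (abs_integral_monotoneOn_mul_cos_le hu hM hn)
    (abs_integral_monotoneOn_mul_cos_le hv hM' hn))

/-- One derivative improves the decay of the coefficients by one power of `n`. -/
theorem exists_abs_cosCoeff_le_succ {G h : ℝ → ℝ} {r : ℕ}
    (hrec : ∀ n : ℕ, cosCoeff G (n + 1) = (cosCoeff h n - cosCoeff h (n + 2)) / (2 * (n + 1)))
    (hh : ∃ C, ∀ n : ℕ, 1 ≤ n → |cosCoeff h n| ≤ C / (n : ℝ) ^ r) :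
    ∃ C, ∀ n : ℕ, 1 ≤ n → |cosCoeff G n| ≤ C / (n : ℝ) ^ (r + 1) := by
  obtain ⟨C, hC⟩ := hh
  have hC0 : 0 ≤ C := by simpa using (abs_nonneg _).trans (hC 1 le_rfl)
  -- The factor 2^r comes from n + 1 ≤ 2n. The first coefficient is added separately, because the
  -- recursion for it involves `cosCoeff h 0`, which the hypothesis does not bound.
  refine ⟨C * 2 ^ r + |cosCoeff G 1|, fun n hn => ?_⟩
  obtain ⟨n, rfl⟩ : ∃ k, n = k + 1 := ⟨n - 1, by omega⟩
  rcases Nat.eq_zero_or_pos n with rfl | hpos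
  · simpa using hC0
  have hn0 : (0 : ℝ) < n := by exact_mod_cast hpos
  have hn1 : (1 : ℝ) ≤ n := by exact_mod_cast hpos
  have key : |cosCoeff G (n + 1)| ≤ C * 2 ^ r / ((n : ℝ) + 1) ^ (r + 1) := by
    have a1 : |cosCoeff h n| ≤ C * 2 ^ r / ((n : ℝ) + 1) ^ r := by
      refine (hC n hpos).trans ?_
      rw [div_le_div_iff₀ (by positivity) (by positivity), mul_assoc, ← mul_pow]
      gcongr
      linarith
    have a2 : |cosCoeff h (n + 2)| ≤ C * 2 ^ r / ((n : ℝ) + 1) ^ r := by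
      refine (hC (n + 2) (by omega)).trans ?_
      push_cast
      rw [div_le_div_iff₀ (by positivity) (by positivity), mul_assoc, ← mul_pow]
      gcongr
      linarith
    rw [hrec, abs_div, abs_of_pos (show (0 : ℝ) < 2 * (n + 1) by positivity)]
    have := (abs_sub (cosCoeff h n) (cosCoeff h (n + 2))).trans (add_le_add a1 a2)
    refine (div_le_div_of_nonneg_right this (by positivity)).trans_eq ?_
    field_simp
    ring
  refine key.trans ?_
  push_cast
  gcongr
  linarith [abs_nonneg (cosCoeff G 1)]

/-- If `f ∈ C^q([-1, 1])`, `f^{(q)}` is absolutely continuous and `f^{(q+1)}` is of bounded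
variation, then the Chebyshev coefficients of `f` are `O(n^{-(q+2)})`. -/
theorem exists_abs_cosCoeff_le_of_contDiffOn (f : ℝ → ℝ) (q : ℕ)
    (hf : ContDiffOn ℝ (q : ℕ∞) f (Set.Icc (-1) 1))
    (hac : AbsolutelyContinuousOnInterval (iteratedDerivWithin q f (Set.Icc (-1) 1)) (-1) 1)
    (hbv : HasDerivOfBoundedVariation (iteratedDerivWithin q f (Set.Icc (-1) 1))) :
    ∃ C, ∀ n : ℕ, 1 ≤ n → |cosCoeff f n| ≤ C / (n : ℝ) ^ (q + 2) := by
  have hu : UniqueDiffOn ℝ (Set.Icc (-1 : ℝ) 1) := uniqueDiffOn_Icc (by norm_num)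
  -- Descending induction on the order of the derivative. Only at the top order q does the
  -- derivative exist merely almost everywhere; below it the next derivative is continuous, hence
  -- bounded.
  have key : ∀ j ≤ q, ∃ C, ∀ n : ℕ, 1 ≤ n →
      |cosCoeff (iteratedDerivWithin (q - j) f (Set.Icc (-1) 1)) n| ≤ C / (n : ℝ) ^ (j + 2) := by
    intro j
    induction j with
    | zero =>
      intro _
      obtain ⟨h, hh, hderiv⟩ := hbv
      obtain ⟨M, hM⟩ : ∃ M, ∀ x ∈ Set.Icc (-1 : ℝ) 1, |h x| ≤ M := by
        obtain ⟨u, v, hu, hv, huv⟩ := hh.exists_monotoneOn_sub_comp_cos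
        obtain ⟨M, hM⟩ := hu.exists_abs_le_Icc
        obtain ⟨M', hM'⟩ := hv.exists_abs_le_Icc
        refine ⟨M + M', fun x hx => ?_⟩
        have hm : Real.arccos x ∈ Set.Icc 0 Real.pi :=
          ⟨Real.arccos_nonneg x, Real.arccos_le_pi x⟩
        rw [← Real.cos_arccos hx.1 hx.2, huv]
        exact (abs_sub _ _).trans (add_le_add (hM _ hm) (hM' _ hm))
      exact exists_abs_cosCoeff_le_succ (cosCoeff_succ_of_ae_hasDerivAt
        (lipschitzOnWith_of_ae_hasDerivAt (by norm_num) hac hM hderiv)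
        hh.intervalIntegrable_comp_cos hderiv) hh.exists_abs_cosCoeff_le
    | succ j ih =>
      intro hj
      obtain ⟨i, hi⟩ : ∃ i, q - j = i + 1 := ⟨q - j - 1, by omega⟩
      have hi' : q - (j + 1) = i := by omega
      have hih := ih (by omega)
      rw [hi'] at *
      rw [hi] at hih
      have hcont : ContinuousOn (iteratedDerivWithin (i + 1) f (Set.Icc (-1) 1))
          (Set.Icc (-1) 1) :=
        hf.continuousOn_iteratedDerivWithin (by exact_mod_cast (by omega : i + 1 ≤ q)) hu
      have hdiff : DifferentiableOn ℝ (iteratedDerivWithin i f (Set.Icc (-1) 1))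
          (Set.Icc (-1) 1) :=
        hf.differentiableOn_iteratedDerivWithin (by exact_mod_cast (by omega : i < q)) hu
      obtain ⟨M, hM⟩ := isCompact_Icc.exists_bound_of_continuousOn hcont
      have hM0 : 0 ≤ M := (norm_nonneg _).trans (hM 0 (by norm_num))
      have hlip : LipschitzOnWith M.toNNReal (iteratedDerivWithin i f (Set.Icc (-1) 1))
          (Set.Icc (-1) 1) := by
        refine (convex_Icc _ _).lipschitzOnWith_of_nnnorm_derivWithin_le hdiff fun x hx => ?_
        rw [← iteratedDerivWithin_succ, ← NNReal.coe_le_coe, Real.coe_toNNReal _ hM0]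
        exact hM x hx
      refine exists_abs_cosCoeff_le_succ (cosCoeff_succ_of_ae_hasDerivAt hlip ?_ ?_) hih
      · refine ContinuousOn.intervalIntegrable ?_
        exact hcont.comp Real.continuous_cos.continuousOn fun θ _ => Real.cos_mem_Icc θ
      · rw [MeasureTheory.Measure.restrict_congr_set MeasureTheory.Ioo_ae_eq_Icc.symm,
          MeasureTheory.ae_restrict_iff' measurableSet_Ioo]
        refine Filter.Eventually.of_forall fun x hx => ?_
        rw [iteratedDerivWithin_succ]
        exact ((hdiff x (Set.Ioo_subset_Icc_self hx)).hasDerivWithinAt).hasDerivAt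
          (Icc_mem_nhds hx.1 hx.2)
  have := key q le_rfl
  simpa using this

/-! ### Pointwise convergence of the Chebyshev series. -/

/-- If the Chebyshev coefficients of a continuous function are absolutely summable, then its
Chebyshev series converges to it pointwise on `[-1, 1]`. -/
theorem hasSum_chebyshevCoeff_mul_eval {f : ℝ → ℝ} (hf : ContinuousOn f (Set.Icc (-1) 1))
    (hsum : Summable fun n => |cosCoeff f n|) {x : ℝ} (hx : x ∈ Set.Icc (-1 : ℝ) 1) :
    HasSum (fun n : ℕ => ((if n = 0 then 1 / 2 else 1) * chebyshevCoeff f n) *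
      (Polynomial.Chebyshev.T ℝ (n : ℤ)).eval x) (f x) := by
  have : Fact (0 < 2 * Real.pi) := ⟨Real.two_pi_pos⟩
  have hmem : ∀ θ : Real.Angle, θ.cos ∈ Set.Icc (-1 : ℝ) 1 := by
    intro θ
    induction θ using Real.Angle.induction_on with
    | h θ => exact Real.cos_mem_Icc θ
  let F : C(AddCircle (2 * Real.pi), ℂ) :=
    ⟨fun θ => (f (Real.Angle.cos θ) : ℂ), Complex.continuous_ofReal.comp
      (hf.comp_continuous Real.Angle.continuous_cos hmem)⟩
  have hF : ∀ θ : ℝ, F (θ : AddCircle (2 * Real.pi)) = (f (Real.cos θ) : ℂ) := fun θ => rfl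
  have hfour : ∀ (k : ℤ) (θ : ℝ), fourier k (θ : AddCircle (2 * Real.pi)) =
      Complex.exp (k * θ * Complex.I) := by
    intro k θ
    rw [fourier_coe_apply]
    congr 1
    have : (Real.pi : ℂ) ≠ 0 := by exact_mod_cast Real.pi_ne_zero
    push_cast
    field_simp
  have hcoef : ∀ k : ℤ, fourierCoeff F k = ((1 / Real.pi * cosCoeff f k.natAbs : ℝ) : ℂ) := by
    intro k
    rw [fourierCoeff_eq_intervalIntegral _ _ (-Real.pi)]
    simp only [hF, hfour]
    have hcont : Continuous fun θ : ℝ => (f (Real.cos θ) : ℂ) :=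
      Complex.continuous_ofReal.comp
        (hf.comp_continuous Real.continuous_cos Real.cos_mem_Icc)
    have hg : Continuous fun θ : ℝ =>
        Complex.exp (((-k : ℤ) : ℂ) * θ * Complex.I) • (f (Real.cos θ) : ℂ) :=
      (by fun_prop : Continuous fun θ : ℝ =>
        Complex.exp (((-k : ℤ) : ℂ) * θ * Complex.I)).smul hcont
    have hg' : Continuous fun θ : ℝ =>
        Complex.exp (((-k : ℤ) : ℂ) * (-θ : ℝ) * Complex.I) • (f (Real.cos (-θ)) : ℂ) :=
      hg.comp continuous_neg
    -- The integral over [-π, π] is folded at 0; since f(cos θ) is even, the two exponentials add up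
    -- to 2 cos(kθ).
    rw [show -Real.pi + 2 * Real.pi = Real.pi by ring,
      ← intervalIntegral.integral_add_adjacent_intervals
        (hg.intervalIntegrable (-Real.pi) 0) (hg.intervalIntegrable 0 Real.pi)]
    have hneg := intervalIntegral.integral_comp_neg (a := 0) (b := Real.pi) (fun θ : ℝ =>
        Complex.exp (((-k : ℤ) : ℂ) * θ * Complex.I) • (f (Real.cos θ) : ℂ))
    rw [neg_zero] at hneg
    rw [← hneg, ← intervalIntegral.integral_add
      (hg'.intervalIntegrable _ _) (hg.intervalIntegrable _ _)]
    have hk : ∀ θ : ℝ, Real.cos ((k.natAbs : ℕ) * θ) = Real.cos (k * θ) := by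
      intro θ
      rw [Nat.cast_natAbs, Int.cast_abs, ← Real.cos_abs (k * θ), abs_mul, ← Real.cos_abs,
        abs_mul, abs_abs]
    have hpt : ∀ θ : ℝ, Complex.exp (((-k : ℤ) : ℂ) * (-θ : ℝ) * Complex.I) •
          (f (Real.cos (-θ)) : ℂ) +
        Complex.exp (((-k : ℤ) : ℂ) * θ * Complex.I) • (f (Real.cos θ) : ℂ) =
        ((2 * (f (Real.cos θ) * Real.cos (k.natAbs * θ)) : ℝ) : ℂ) := by
      intro θ
      rw [hk, Real.cos_neg]
      push_cast
      rw [Complex.cos]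
      simp only [smul_eq_mul]
      ring_nf
    simp only [hpt]
    rw [intervalIntegral.integral_ofReal, intervalIntegral.integral_const_mul, cosCoeff,
      Complex.real_smul, ← Complex.ofReal_mul]
    congr 1
    field_simp
  have hS : Summable (fourierCoeff F) := by
    have h1 : Summable fun n : ℕ => ((1 / Real.pi * cosCoeff f n : ℝ) : ℂ) :=
      Complex.summable_ofReal.2 ((summable_abs_iff.1 hsum).mul_left _)
    refine Summable.of_nat_of_neg ?_ ?_ <;> simpa [hcoef] using h1
  have hpw := (has_pointwise_sum_fourier_series_of_summable hS
    ((Real.arccos x : ℝ) : AddCircle (2 * Real.pi))).nat_add_neg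
  rw [hF, Real.cos_arccos hx.1 hx.2] at hpw
  have hterm : ∀ n : ℕ, (2 / Real.pi * cosCoeff f n * Real.cos (n * Real.arccos x) : ℝ) =
      fourierCoeff F n • fourier (n : ℤ) ((Real.arccos x : ℝ) : AddCircle (2 * Real.pi)) +
      fourierCoeff F (-n) • fourier (-n : ℤ) ((Real.arccos x : ℝ) : AddCircle (2 * Real.pi)) := by
    intro n
    rw [hfour, hfour, hcoef, hcoef, Int.natAbs_neg, Int.natAbs_natCast]
    push_cast
    rw [Complex.cos]
    simp only [smul_eq_mul]
    ring_nf
  simp only [← hterm] at hpw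
  have hz : fourierCoeff F 0 • fourier 0 ((Real.arccos x : ℝ) : AddCircle (2 * Real.pi)) =
      ((1 / Real.pi * cosCoeff f 0 : ℝ) : ℂ) := by
    rw [hcoef]
    simp
  rw [hz, ← Complex.ofReal_add, Complex.hasSum_ofReal] at hpw
  -- Pairing n with -n counts the index 0 twice. Removing one copy leaves the weight 1/2 of the
  -- zeroth coefficient.
  have hfin := hpw.sub (hasSum_ite_eq 0 (1 / Real.pi * cosCoeff f 0))
  rw [add_sub_cancel_right] at hfin
  refine (funext fun n => ?_ : (fun n : ℕ => _) = _) ▸ hfin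
  have hT := Polynomial.Chebyshev.T_real_cos (Real.arccos x) n
  rw [Real.cos_arccos hx.1 hx.2] at hT
  rw [hT, chebyshevCoeff_eq_cosCoeff]
  by_cases hn : n = 0
  · subst hn
    simp
    ring
  · simp [hn]

/-! ### Termwise differentiation in the interior and tail estimates. -/

/-- Away from ±1 a derivative costs only one power of n. The differentiated Chebyshev equation
(1-x²) T^{(s+2)} = (2s+1) x T^{(s+1)} - (n²-s²) T^{(s)} gives a two-step recursion, as 1-x² ≥ 1-δ² >
0. For s = 1, T_n' = n U_{n-1} and U_{n-1}(cos θ) sin θ = sin(nθ). -/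
theorem exists_abs_iterate_derivative_chebyshev_le {δ : ℝ} (hδ1 : δ < 1) (s : ℕ) :
    ∃ C, 0 ≤ C ∧ ∀ n : ℕ, ∀ x : ℝ, |x| ≤ δ →
      |(Polynomial.derivative^[s] (Polynomial.Chebyshev.T ℝ (n : ℤ))).eval x| ≤
        C * (n : ℝ) ^ s := by
  rcases lt_or_ge δ 0 with hδ | hδ0
  · exact ⟨0, le_rfl, fun n x hx => absurd ((abs_nonneg x).trans hx) (not_le.2 hδ)⟩
  have hd : 0 < 1 - δ ^ 2 := by nlinarith
  have hx2 : ∀ x : ℝ, |x| ≤ δ → 1 - δ ^ 2 ≤ 1 - x ^ 2 := by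
    intro x hx
    have := pow_le_pow_left₀ (abs_nonneg x) hx 2
    rw [sq_abs] at this
    linarith
  induction s using Nat.twoStepInduction with
  | zero =>
    exact ⟨1, zero_le_one, fun n x hx => by
      simpa using Polynomial.Chebyshev.abs_eval_T_real_le_one n (hx.trans hδ1.le)⟩
  | one =>
    refine ⟨1 / (1 - δ ^ 2), by positivity, fun n x hx => ?_⟩
    have hx1 := abs_le.1 (hx.trans hδ1.le)
    rw [Function.iterate_one, Polynomial.Chebyshev.T_derivative_eq_U, pow_one]
    have hU := Polynomial.Chebyshev.U_real_cos (Real.arccos x) ((n : ℤ) - 1)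
    rw [Real.cos_arccos hx1.1 hx1.2, Real.sin_arccos] at hU
    have hsq : 1 - δ ^ 2 ≤ √(1 - x ^ 2) := by
      refine Real.le_sqrt_of_sq_le ?_
      nlinarith [hx2 x hx, sq_nonneg δ]
    have hUle : |(Polynomial.Chebyshev.U ℝ ((n : ℤ) - 1)).eval x| ≤ 1 / (1 - δ ^ 2) := by
      rw [le_div_iff₀ hd]
      calc _ ≤ |(Polynomial.Chebyshev.U ℝ ((n : ℤ) - 1)).eval x| * √(1 - x ^ 2) := by gcongr
        _ = |(Polynomial.Chebyshev.U ℝ ((n : ℤ) - 1)).eval x * √(1 - x ^ 2)| := by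
          rw [abs_mul, abs_of_nonneg (Real.sqrt_nonneg _)]
        _ ≤ 1 := by rw [hU]; exact Real.abs_sin_le_one _
    simp only [Int.cast_natCast, Polynomial.eval_mul, Polynomial.eval_natCast, abs_mul,
      Nat.abs_cast]
    rw [mul_comm]
    gcongr
  | more s ih0 ih1 =>
    obtain ⟨C₀, hC₀, h₀⟩ := ih0
    obtain ⟨C₁, hC₁, h₁⟩ := ih1
    refine ⟨((2 * s + 1) * C₁ + (1 + s ^ 2) * C₀) / (1 - δ ^ 2), by positivity, fun n x hx => ?_⟩
    rcases Nat.eq_zero_or_pos n with rfl | hn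
    · simp [Function.iterate_succ_apply]
    have hn1 : (1 : ℝ) ≤ n := by exact_mod_cast hn
    have hode := Polynomial.Chebyshev.one_sub_X_sq_mul_iterate_derivative_T_eval (n : ℤ) s x
    have hδx := hx2 x hx
    set a := (Polynomial.derivative^[s + 2] (Polynomial.Chebyshev.T ℝ (n : ℤ))).eval x
    set b := (Polynomial.derivative^[s + 1] (Polynomial.Chebyshev.T ℝ (n : ℤ))).eval x
    set c := (Polynomial.derivative^[s] (Polynomial.Chebyshev.T ℝ (n : ℤ))).eval x
    have hb : |b| ≤ C₁ * (n : ℝ) ^ (s + 1) := h₁ n x hx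
    have hc : |c| ≤ C₀ * (n : ℝ) ^ s := h₀ n x hx
    rw [div_mul_eq_mul_div, le_div_iff₀ hd]
    calc |a| * (1 - δ ^ 2) ≤ |a| * (1 - x ^ 2) := by gcongr
      _ = |(1 - x ^ 2) * a| := by rw [abs_mul, abs_of_nonneg (hd.le.trans hδx), mul_comm]
      _ ≤ |(2 * s + 1) * x * b| + |((n : ℝ) ^ 2 - s ^ 2) * c| := by
        rw [hode]
        exact abs_sub _ _
      _ = (2 * s + 1) * |x| * |b| + |(n : ℝ) ^ 2 - s ^ 2| * |c| := by
        rw [abs_mul, abs_mul, abs_mul, abs_of_nonneg (by positivity : (0 : ℝ) ≤ 2 * s + 1)]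
      _ ≤ (2 * s + 1) * 1 * (C₁ * (n : ℝ) ^ (s + 2)) +
          ((1 + s ^ 2) * n ^ 2) * (C₀ * (n : ℝ) ^ s) := by
        have e1 : (n : ℝ) ^ (s + 1) ≤ (n : ℝ) ^ (s + 2) := pow_le_pow_right₀ hn1 (by omega)
        have e2 : |(n : ℝ) ^ 2 - s ^ 2| ≤ (1 + s ^ 2) * n ^ 2 := by
          refine (abs_sub _ _).trans ?_
          rw [abs_of_nonneg (sq_nonneg _), abs_of_nonneg (sq_nonneg _)]
          nlinarith [one_le_pow₀ hn1 (n := 2), sq_nonneg (s : ℝ)]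
        have e3 : |b| ≤ C₁ * (n : ℝ) ^ (s + 2) := hb.trans (by gcongr)
        have e4 : |x| ≤ 1 := hx.trans hδ1.le
        gcongr
      _ = ((2 * s + 1) * C₁ + (1 + s ^ 2) * C₀) * (n : ℝ) ^ (s + 2) := by ring

/-- A pointwise convergent Chebyshev series with sufficiently fast decaying coefficients may be
differentiated termwise in the interior of `[-1, 1]`. -/
theorem hasSum_mul_iterate_derivative_chebyshev {f : ℝ → ℝ} {a : ℕ → ℝ} {δ : ℝ} (hδ1 : δ < 1)
    (hf : ∀ x ∈ Set.Icc (-1 : ℝ) 1,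
      HasSum (fun n : ℕ => a n * (Polynomial.Chebyshev.T ℝ (n : ℤ)).eval x) (f x))
    (s : ℕ) (ha : Summable fun n : ℕ => |a n| * (n : ℝ) ^ s) {x : ℝ} (hx : x ∈ Set.Ioo (-δ) δ) :
    HasSum (fun n : ℕ => a n *
        (Polynomial.derivative^[s] (Polynomial.Chebyshev.T ℝ (n : ℤ))).eval x)
      (iteratedDerivWithin s f (Set.Icc (-1) 1) x) := by
  have hsub : Set.Ioo (-δ) δ ⊆ Set.Ioo (-1 : ℝ) 1 := Set.Ioo_subset_Ioo (by linarith) hδ1.le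
  induction s generalizing x with
  | zero =>
    simpa using hf x (Set.Ioo_subset_Icc_self (hsub hx))
  | succ s ih =>
    -- The extra term is needed for n = 0, where 0^0 = 1 when s = 0.
    have hle : ∀ n : ℕ, |a n| * (n : ℝ) ^ s ≤
        |a n| * (n : ℝ) ^ (s + 1) + if n = 0 then |a 0| else 0 := by
      intro n
      rcases Nat.eq_zero_or_pos n with rfl | hn
      · have : (0 : ℝ) ^ s ≤ 1 := pow_le_one₀ le_rfl zero_le_one
        simpa using mul_le_of_le_one_right (abs_nonneg (a 0)) this
      · have hn1 : (1 : ℝ) ≤ n := by exact_mod_cast hn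
        have : (n : ℝ) ^ s ≤ (n : ℝ) ^ (s + 1) := pow_le_pow_right₀ hn1 (by omega)
        rw [if_neg hn.ne', add_zero]
        gcongr
    have has : Summable fun n : ℕ => |a n| * (n : ℝ) ^ s :=
      Summable.of_nonneg_of_le (fun n => by positivity) hle
        (ha.add (hasSum_ite_eq 0 |a 0|).summable)
    obtain ⟨C, hC0, hC⟩ := exists_abs_iterate_derivative_chebyshev_le hδ1 (s + 1)
    have hbound : ∀ (n : ℕ) (y : ℝ), y ∈ Set.Ioo (-δ) δ → ‖a n *
        (Polynomial.derivative^[s + 1] (Polynomial.Chebyshev.T ℝ (n : ℤ))).eval y‖ ≤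
        C * (|a n| * (n : ℝ) ^ (s + 1)) := by
      intro n y hy
      rw [norm_mul, Real.norm_eq_abs, Real.norm_eq_abs]
      calc _ ≤ |a n| * (C * (n : ℝ) ^ (s + 1)) := by
            gcongr
            exact hC n y (abs_le.2 ⟨hy.1.le, hy.2.le⟩)
        _ = _ := by ring
    have hder := hasDerivAt_tsum_of_isPreconnected
      (g := fun (n : ℕ) (y : ℝ) => a n *
        (Polynomial.derivative^[s] (Polynomial.Chebyshev.T ℝ (n : ℤ))).eval y)
      (g' := fun (n : ℕ) (y : ℝ) => a n *
        (Polynomial.derivative^[s + 1] (Polynomial.Chebyshev.T ℝ (n : ℤ))).eval y)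
      (ha.mul_left C) isOpen_Ioo isPreconnected_Ioo
      (fun n y _ => by
        rw [Function.iterate_succ_apply']
        exact (Polynomial.hasDerivAt _ y).const_mul (a n))
      hbound hx (ih has hx).summable hx
    -- Differentiating the induction hypothesis requires it on a neighbourhood of x; this is why the
    -- interval is open and the induction generalizes x.
    have heq : (fun y => ∑' n : ℕ, a n *
        (Polynomial.derivative^[s] (Polynomial.Chebyshev.T ℝ (n : ℤ))).eval y) =ᶠ[nhds x]
        iteratedDerivWithin s f (Set.Icc (-1) 1) := by
      filter_upwards [isOpen_Ioo.mem_nhds hx] with y hy using (ih has hy).tsum_eq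
    have hmem : Set.Icc (-1 : ℝ) 1 ∈ nhds x := Icc_mem_nhds (hsub hx).1 (hsub hx).2
    have hsm : Summable fun n : ℕ => a n *
        (Polynomial.derivative^[s + 1] (Polynomial.Chebyshev.T ℝ (n : ℤ))).eval x :=
      Summable.of_norm_bounded (ha.mul_left C) fun n => hbound n x hx
    rw [iteratedDerivWithin_succ, derivWithin_of_mem_nhds hmem,
      (hder.congr_of_eventuallyEq heq.symm).deriv]
    exact hsm.hasSum

/-- For n > N one has n^{-(r+2)} ≤ N^{-r} n^{-2}, and the sum of n^{-2} beyond N is at most 1/N by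
telescoping. The bound for finite sections passes to the limit. -/
theorem tsum_tail_le {b : ℕ → ℝ} {K : ℝ} (hK : 0 ≤ K) {r N : ℕ} (hN : 1 ≤ N)
    (hb : ∀ n : ℕ, 1 ≤ n → |b n| ≤ K / (n : ℝ) ^ (r + 2)) {v : ℝ} (hv : HasSum b v) :
    |∑ n ∈ Finset.range (N + 1), b n - v| ≤ K / (N : ℝ) ^ (r + 1) := by
  have hN0 : (0 : ℝ) < N := by exact_mod_cast hN
  have hpart : ∀ M, N ≤ M → |∑ n ∈ Finset.range (N + 1), b n - ∑ n ∈ Finset.range (M + 1), b n| ≤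
      K / (N : ℝ) ^ (r + 1) := by
    intro M hM
    rw [abs_sub_comm, ← Finset.sum_Ico_eq_sub _ (by omega : N + 1 ≤ M + 1)]
    have hset : Finset.Ico (N + 1) (M + 1) = Finset.Ioc N M := by ext; simp
    rw [hset]
    calc _ ≤ ∑ n ∈ Finset.Ioc N M, |b n| := Finset.abs_sum_le_sum_abs _ _
      _ ≤ ∑ n ∈ Finset.Ioc N M, K / (N : ℝ) ^ r * ((n : ℝ) ^ 2)⁻¹ := by
        refine Finset.sum_le_sum fun n hn => ?_
        rw [Finset.mem_Ioc] at hn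
        have hNn : (N : ℝ) ≤ n := by exact_mod_cast hn.1.le
        refine (hb n (by omega)).trans ?_
        rw [pow_add, ← div_eq_mul_inv, div_div]
        have : (0 : ℝ) < n := hN0.trans_le hNn
        gcongr
      _ = K / (N : ℝ) ^ r * ∑ n ∈ Finset.Ioc N M, ((n : ℝ) ^ 2)⁻¹ := by rw [Finset.mul_sum]
      _ ≤ K / (N : ℝ) ^ r * (N : ℝ)⁻¹ := by
        gcongr
        refine (sum_Ioc_inv_sq_le_sub (by omega) hM).trans ?_
        simp
      _ = K / (N : ℝ) ^ (r + 1) := by rw [pow_succ]; field_simp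
  have hlim := ((hv.tendsto_sum_nat.comp (Filter.tendsto_add_atTop_nat 1)).const_sub
    (∑ n ∈ Finset.range (N + 1), b n)).abs
  exact le_of_tendsto hlim (Filter.eventually_atTop.2 ⟨N, hpart⟩)

/-! ### Functions of Jordan matrices, and semisimple eigenvalues. -/

theorem mul_jordanBlock_apply {n : ℕ} (M : Matrix (Fin n) (Fin n) ℝ) (lam : ℝ) (i j : Fin n) :
    (M * jordanBlock n lam) i j = M i j * lam +
      if h : 0 < (j : ℕ) then M i ⟨(j : ℕ) - 1, by omega⟩ else 0 := by
  have hJ : ∀ r : Fin n, jordanBlock n lam r j =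
      (if r = j then lam else 0) + if (r : ℕ) + 1 = j then 1 else 0 := by
    intro r
    by_cases h : r = j
    · subst h
      simp [jordanBlock]
    · simp [jordanBlock, h]
  simp only [Matrix.mul_apply, hJ, mul_add, mul_ite, mul_zero, mul_one, Finset.sum_add_distrib,
    Finset.sum_ite_eq', Finset.mem_univ, if_true]
  congr 1
  split_ifs with h
  · rw [Finset.sum_eq_single ⟨(j : ℕ) - 1, by omega⟩]
    · rw [if_pos (by simp; omega)]
    · intro r _ hr
      rw [if_neg]
      intro h'
      exact hr (Fin.ext (by simp; omega))
    · simp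
  · exact Finset.sum_eq_zero fun r _ => if_neg (by omega)

/-- The value of a polynomial at a Jordan block. -/
theorem aeval_jordanBlock_apply {n : ℕ} (lam : ℝ) (p : Polynomial ℝ) (i j : Fin n) :
    Polynomial.aeval (jordanBlock n lam) p i j =
      if i ≤ j then (Polynomial.derivative^[(j : ℕ) - (i : ℕ)] p).eval lam /
        (Nat.factorial ((j : ℕ) - (i : ℕ)) : ℝ) else 0 := by
  induction p using Polynomial.induction_on generalizing j with
  | C a =>
    rw [Polynomial.aeval_C, Matrix.algebraMap_matrix_apply]
    rcases lt_trichotomy i j with h | h | h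
    · obtain ⟨k, hk⟩ : ∃ k, (j : ℕ) - i = k + 1 := ⟨(j : ℕ) - i - 1, by omega⟩
      simp [h.ne, h.le, hk, Function.iterate_succ_apply]
    · subst h
      simp
    · simp [h.ne', not_le.2 h]
  | add p q hp hq =>
    rw [map_add, Matrix.add_apply, hp, hq]
    split_ifs
    · rw [iterate_map_add, Polynomial.eval_add, add_div]
    · simp
  | monomial m a ih =>
    rw [pow_succ, ← mul_assoc, map_mul, Polynomial.aeval_X, mul_jordanBlock_apply]
    generalize Polynomial.C a * Polynomial.X ^ m = p at ih ⊢
    rw [ih, Polynomial.iterate_derivative_mul_X]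
    rcases lt_trichotomy i j with h | h | h
    · obtain ⟨k, hk⟩ : ∃ k, (j : ℕ) - i = k + 1 := ⟨(j : ℕ) - i - 1, by omega⟩
      have hj : 0 < (j : ℕ) := by omega
      have hij : i ≤ (⟨(j : ℕ) - 1, by omega⟩ : Fin n) := by
        rw [Fin.le_def]
        simp only
        omega
      have hk' : (j : ℕ) - 1 - i = k := by omega
      -- By Leibniz (pX)^{(k+1)} = X p^{(k+1)} + (k+1) p^{(k)}. Divided by (k+1)!, the two terms are
      -- the diagonal and the superdiagonal contributions of the Jordan block.
      rw [dif_pos hj, ih, if_pos h.le, if_pos hij, if_pos h.le]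
      simp only [hk, hk', Nat.factorial_succ, Polynomial.eval_add, Polynomial.eval_mul,
        Polynomial.eval_X, add_tsub_cancel_right, nsmul_eq_mul, Polynomial.eval_natCast]
      push_cast
      have : (k.factorial : ℝ) ≠ 0 := by positivity
      field_simp
    · subst h
      have : ∀ h : 0 < (i : ℕ), ¬ i ≤ (⟨(i : ℕ) - 1, by omega⟩ : Fin n) := by
        intro h
        rw [Fin.le_def]
        simp only
        omega
      rw [if_pos le_rfl, if_pos le_rfl]
      split_ifs with h1
      · rw [ih, if_neg (this h1)]
        simp
      · simp
    · rw [if_neg (not_le.2 h), if_neg (not_le.2 h)]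
      split_ifs with h1
      · rw [ih, if_neg]
        · simp
        · rw [Fin.le_def]
          simp only
          have : (j : ℕ) < i := h
          omega
      · simp

namespace JordanDecomposition

variable {k : ℕ} {A : Matrix (Fin k) (Fin k) ℝ}

/-- The matrix `Z⁻¹ B Z` for `B` block diagonal with the given blocks. -/
noncomputable def conjBlocks (D : JordanDecomposition A) :
    (∀ i, Matrix (Fin (D.size i)) (Fin (D.size i)) ℝ) → Matrix (Fin k) (Fin k) ℝ :=
  fun B => D.Z⁻¹ * Matrix.reindex D.idx D.idx (Matrix.blockDiagonal' B) * D.Z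

theorem conjBlocks_add (D : JordanDecomposition A)
    (B B' : ∀ i, Matrix (Fin (D.size i)) (Fin (D.size i)) ℝ) :
    D.conjBlocks (B + B') = D.conjBlocks B + D.conjBlocks B' := by
  simp only [conjBlocks, Matrix.blockDiagonal'_add, Matrix.reindex_apply, Matrix.submatrix_add,
    Pi.add_apply, Matrix.mul_add, Matrix.add_mul]

theorem conjBlocks_sub (D : JordanDecomposition A)
    (B B' : ∀ i, Matrix (Fin (D.size i)) (Fin (D.size i)) ℝ) :
    D.conjBlocks (B - B') = D.conjBlocks B - D.conjBlocks B' := by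
  simp only [conjBlocks, Matrix.blockDiagonal'_sub, Matrix.reindex_apply, Matrix.submatrix_sub,
    Pi.sub_apply, Matrix.mul_sub, Matrix.sub_mul]

theorem conjBlocks_smul (D : JordanDecomposition A) (c : ℝ)
    (B : ∀ i, Matrix (Fin (D.size i)) (Fin (D.size i)) ℝ) :
    D.conjBlocks (c • B) = c • D.conjBlocks B := by
  simp only [conjBlocks, Matrix.blockDiagonal'_smul, Matrix.reindex_apply, Matrix.submatrix_smul,
    Pi.smul_apply, Matrix.mul_smul, Matrix.smul_mul]

theorem conjBlocks_one (D : JordanDecomposition A) : D.conjBlocks 1 = 1 := by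
  simp only [conjBlocks, Matrix.blockDiagonal'_one, Matrix.reindex_apply,
    Matrix.submatrix_one_equiv, Matrix.mul_one]
  exact Matrix.nonsing_inv_mul _ D.isUnit_det

theorem conjBlocks_mul (D : JordanDecomposition A)
    (B B' : ∀ i, Matrix (Fin (D.size i)) (Fin (D.size i)) ℝ) :
    D.conjBlocks (B * B') = D.conjBlocks B * D.conjBlocks B' := by
  have h : D.Z * D.Z⁻¹ = 1 := Matrix.mul_nonsing_inv _ D.isUnit_det
  have h' : Matrix.blockDiagonal' (B * B') =
      Matrix.blockDiagonal' B * Matrix.blockDiagonal' B' := Matrix.blockDiagonal'_mul B B'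
  simp only [conjBlocks, h', Matrix.reindex_apply]
  rw [← Matrix.submatrix_mul_equiv _ _ _ D.idx.symm _]
  simp only [Matrix.mul_assoc]
  rw [← Matrix.mul_assoc D.Z D.Z⁻¹, h, Matrix.one_mul]

/-- `conjBlocks` is a unital algebra homomorphism that sends the family of Jordan blocks to `A`, so
it commutes with polynomials. -/
theorem aeval_eq_conjBlocks (D : JordanDecomposition A) (p : Polynomial ℝ) :
    Polynomial.aeval A p =
      D.conjBlocks fun i => Polynomial.aeval (jordanBlock (D.size i) (D.eigenvalue i)) p := by
  have hA : A = D.conjBlocks fun i => jordanBlock (D.size i) (D.eigenvalue i) := D.eq_conj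
  induction p using Polynomial.induction_on with
  | C a =>
    simp only [Polynomial.aeval_C, Algebra.algebraMap_eq_smul_one]
    rw [← D.conjBlocks_one, ← D.conjBlocks_smul]
    rfl
  | add p q hp hq =>
    simp only [map_add]
    rw [hp, hq, ← D.conjBlocks_add]
    rfl
  | monomial n a ih =>
    simp only [pow_succ, ← mul_assoc]
    simp only [map_mul _ _ Polynomial.X, Polynomial.aeval_X]
    rw [ih]
    exact (congrArg (_ * ·) hA).trans (D.conjBlocks_mul _ _).symm

/-- Expansion in matrix units: the norms of the units are the only constants, so nothing depends on
`D` except the factor from `Z`. -/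
theorem norm_conjBlocks_le (D : JordanDecomposition A)
    (ν : AlgebraNorm ℝ (Matrix (Fin k) (Fin k) ℝ)) {ε : ℝ} (hε : 0 ≤ ε)
    (B : ∀ i, Matrix (Fin (D.size i)) (Fin (D.size i)) ℝ) (hB : ∀ i r s, |B i r s| ≤ ε) :
    ν (D.conjBlocks B) ≤ (∑ i, ∑ j, ν (Matrix.single i j (1 : ℝ))) * (ν D.Z⁻¹ * ν D.Z) * ε := by
  set E := Matrix.reindex D.idx D.idx (Matrix.blockDiagonal' B) with hE
  have hEle : ∀ i j, |E i j| ≤ ε := by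
    intro i j
    simp only [hE, Matrix.reindex_apply, Matrix.submatrix_apply, Matrix.blockDiagonal'_apply]
    split_ifs
    · exact hB _ _ _
    · simpa using hε
  have hνE : ν E ≤ (∑ i, ∑ j, ν (Matrix.single i j (1 : ℝ))) * ε := by
    rw [Matrix.matrix_eq_sum_single E, Finset.sum_mul]
    refine (Finset.le_sum_of_subadditive ν (map_zero ν).le (map_add_le_add ν) _ _).trans
      (Finset.sum_le_sum fun i _ => ?_)
    rw [Finset.sum_mul]
    refine (Finset.le_sum_of_subadditive ν (map_zero ν).le (map_add_le_add ν) _ _).trans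
      (Finset.sum_le_sum fun j _ => ?_)
    have : Matrix.single i j (E i j) = E i j • Matrix.single i j (1 : ℝ) := by
      rw [Matrix.smul_single, smul_eq_mul, mul_one]
    rw [this, map_smul_eq_mul, mul_comm]
    exact mul_le_mul_of_nonneg_left (hEle i j) (apply_nonneg ν _)
  calc ν (D.conjBlocks B) ≤ ν (D.Z⁻¹ * E) * ν D.Z := map_mul_le_mul ν _ _
    _ ≤ (ν D.Z⁻¹ * ν E) * ν D.Z :=
      mul_le_mul_of_nonneg_right (map_mul_le_mul ν _ _) (apply_nonneg ν _)
    _ = (ν D.Z⁻¹ * ν D.Z) * ν E := by ring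
    _ ≤ (ν D.Z⁻¹ * ν D.Z) * ((∑ i, ∑ j, ν (Matrix.single i j (1 : ℝ))) * ε) :=
      mul_le_mul_of_nonneg_left hνE (mul_nonneg (apply_nonneg ν _) (apply_nonneg ν _))
    _ = _ := by ring

/-- The Jordan basis vector of index `s` in the block `i`. -/
noncomputable def jordanVector (D : JordanDecomposition A) (i : Fin D.numBlocks)
    (s : Fin (D.size i)) : Fin k → ℝ :=
  D.Z⁻¹.mulVec (Pi.single (D.idx ⟨i, s⟩) 1)

theorem jordanVector_ne_zero (D : JordanDecomposition A) (i : Fin D.numBlocks)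
    (s : Fin (D.size i)) : D.jordanVector i s ≠ 0 := by
  intro h
  have h1 := congrArg D.Z.mulVec h
  rw [jordanVector, Matrix.mulVec_mulVec, Matrix.mul_nonsing_inv _ D.isUnit_det,
    Matrix.one_mulVec, Matrix.mulVec_zero] at h1
  simpa using congrFun h1 (D.idx ⟨i, s⟩)

/-- The identity A Z⁻¹ = Z⁻¹ J, read column by column. -/
theorem mulVec_jordanVector (D : JordanDecomposition A) (i : Fin D.numBlocks)
    (s : Fin (D.size i)) :
    A.mulVec (D.jordanVector i s) =
      ∑ r, jordanBlock (D.size i) (D.eigenvalue i) r s • D.jordanVector i r := by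
  have hcol : (Matrix.reindex D.idx D.idx (Matrix.blockDiagonal' fun i =>
      jordanBlock (D.size i) (D.eigenvalue i))).mulVec (Pi.single (D.idx ⟨i, s⟩) 1) =
      ∑ r, jordanBlock (D.size i) (D.eigenvalue i) r s •
        (Pi.single (D.idx ⟨i, r⟩) 1 : Fin k → ℝ) := by
    ext a
    obtain ⟨⟨j, t⟩, rfl⟩ := D.idx.surjective a
    rw [Matrix.mulVec_single_one]
    simp only [Matrix.col_apply, Matrix.reindex_apply, Matrix.submatrix_apply,
      Equiv.symm_apply_apply, Finset.sum_apply, Pi.smul_apply, Pi.single_apply,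
      D.idx.injective.eq_iff, smul_eq_mul, mul_ite, mul_one, mul_zero]
    by_cases hj : j = i
    · subst hj
      simp [Matrix.blockDiagonal'_apply_eq]
    · rw [Matrix.blockDiagonal'_apply_ne _ _ _ hj]
      refine (Finset.sum_eq_zero fun r _ => if_neg fun h => hj ?_).symm
      exact congrArg Sigma.fst h
  nth_rewrite 1 [D.eq_conj]
  rw [jordanVector, Matrix.mulVec_mulVec, Matrix.mul_assoc, Matrix.mul_nonsing_inv _ D.isUnit_det,
    Matrix.mul_one, ← Matrix.mulVec_mulVec, hcol, Matrix.mulVec_sum]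
  simp only [Matrix.mulVec_smul, jordanVector]

theorem mulVec_jordanVector_zero (D : JordanDecomposition A) (i : Fin D.numBlocks) :
    A.mulVec (D.jordanVector i ⟨0, D.size_pos i⟩) =
      D.eigenvalue i • D.jordanVector i ⟨0, D.size_pos i⟩ := by
  rw [mulVec_jordanVector, Finset.sum_eq_single ⟨0, D.size_pos i⟩]
  · simp [jordanBlock]
  · intro r _ hr
    simp [jordanBlock, hr]
  · simp

theorem mulVec_jordanVector_one (D : JordanDecomposition A) (i : Fin D.numBlocks)
    (hi : 1 < D.size i) :
    A.mulVec (D.jordanVector i ⟨1, hi⟩) =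
      D.eigenvalue i • D.jordanVector i ⟨1, hi⟩ + D.jordanVector i ⟨0, D.size_pos i⟩ := by
  rw [mulVec_jordanVector, Fintype.sum_eq_add ⟨1, hi⟩ ⟨0, D.size_pos i⟩]
  · simp [jordanBlock]
  · simp
  · rintro r ⟨hr, hr'⟩
    have : ¬ (r : ℕ) = 0 := fun h => hr' (Fin.ext h)
    simp [jordanBlock, hr, this]

theorem hasEigenvalue (D : JordanDecomposition A) (i : Fin D.numBlocks) :
    Module.End.HasEigenvalue (Matrix.toLin' A) (D.eigenvalue i) := by
  refine Module.End.hasEigenvalue_of_hasEigenvector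
    (x := D.jordanVector i ⟨0, D.size_pos i⟩) ⟨?_, D.jordanVector_ne_zero _ _⟩
  rw [Module.End.mem_eigenspace_iff, Matrix.toLin'_apply, mulVec_jordanVector_zero]

theorem abs_eigenvalue_le_one (D : JordanDecomposition A) (hA : spectralRadius ℝ A ≤ 1)
    (i : Fin D.numBlocks) : |D.eigenvalue i| ≤ 1 := by
  have hmem : D.eigenvalue i ∈ spectrum ℝ A := by
    rw [← Matrix.spectrum_toLin']
    exact (D.hasEigenvalue i).mem_spectrum
  have h : (‖D.eigenvalue i‖₊ : ENNReal) ≤ 1 :=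
    (le_iSup₂ (f := fun (c : ℝ) (_ : c ∈ spectrum ℝ A) => (‖c‖₊ : ENNReal)) _ hmem).trans hA
  have h' : ‖D.eigenvalue i‖₊ ≤ 1 := by exact_mod_cast h
  exact_mod_cast h'

/-- The blocks of a semisimple eigenvalue have size one. -/
theorem size_eq_one_of_isSemisimple (D : JordanDecomposition A) (i : Fin D.numBlocks)
    (hs : IsSemisimpleEigenvalue A (D.eigenvalue i)) : D.size i = 1 := by
  by_contra hne
  have hi : 1 < D.size i := lt_of_le_of_ne (D.size_pos i) (Ne.symm hne)
  -- The dimension of the maximal generalized eigenspace is the algebraic multiplicity, so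
  -- semisimplicity makes it equal to the eigenspace. The second vector of a Jordan chain lies in
  -- the former but not in the latter.
  have hle : Module.End.eigenspace (Matrix.toLin' A) (D.eigenvalue i) ≤
      Module.End.maxGenEigenspace (Matrix.toLin' A) (D.eigenvalue i) :=
    Module.End.genEigenspace_le_maximal _ _ 1
  have heq := Submodule.eq_of_le_of_finrank_eq hle (by
    rw [LinearMap.finrank_maxGenEigenspace_eq, Matrix.charpoly_toLin', hs.2])
  have h1 : (Matrix.toLin' A - D.eigenvalue i • 1) (D.jordanVector i ⟨1, hi⟩) =
      D.jordanVector i ⟨0, D.size_pos i⟩ := by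
    simp [mulVec_jordanVector_one]
  have h0 : (Matrix.toLin' A - D.eigenvalue i • 1) (D.jordanVector i ⟨0, D.size_pos i⟩) = 0 := by
    simp [mulVec_jordanVector_zero]
  have hmem : D.jordanVector i ⟨1, hi⟩ ∈
      Module.End.maxGenEigenspace (Matrix.toLin' A) (D.eigenvalue i) := by
    rw [Module.End.mem_maxGenEigenspace]
    exact ⟨2, by rw [pow_two, Module.End.mul_apply, h1, h0]⟩
  rw [← heq, Module.End.mem_eigenspace_iff, Matrix.toLin'_apply, mulVec_jordanVector_one] at hmem
  exact D.jordanVector_ne_zero _ _ (by simpa using hmem)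

end JordanDecomposition

/-! ### The scalar error bound and the theorem. -/

/-- The Chebyshev expansion of `f` converges, together with its derivatives of order below `m`, at
the rate `N^{-(ℓ+1)}` on `(-δ, δ)`, and the expansion itself does so on `[-1, 1]`. -/
theorem exists_chebyshev_error_le {m ℓ : ℕ} (hm : 1 < m) {δ : ℝ} (hδ1 : δ < 1) {f : ℝ → ℝ}
    (hf : ContDiffOn ℝ ((m - 1 + ℓ : ℕ) : ℕ∞) f (Set.Icc (-1) 1))
    (hac : AbsolutelyContinuousOnInterval
      (iteratedDerivWithin (m - 1 + ℓ) f (Set.Icc (-1) 1)) (-1) 1)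
    (hbv : HasDerivOfBoundedVariation (iteratedDerivWithin (m - 1 + ℓ) f (Set.Icc (-1) 1))) :
    ∃ K, 0 ≤ K ∧ ∀ s < m, ∀ lam : ℝ,
      lam ∈ Set.Ioo (-δ) δ ∨ s = 0 ∧ lam ∈ Set.Icc (-1 : ℝ) 1 → ∀ N : ℕ, 1 ≤ N →
        |∑ n ∈ Finset.range (N + 1), ((if n = 0 then 1 / 2 else 1) * chebyshevCoeff f n) *
            (Polynomial.derivative^[s] (Polynomial.Chebyshev.T ℝ (n : ℤ))).eval lam -
          iteratedDerivWithin s f (Set.Icc (-1) 1) lam| ≤ K / (N : ℝ) ^ (ℓ + 1) := by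
  obtain ⟨C, hC⟩ := exists_abs_cosCoeff_le_of_contDiffOn f _ hf hac hbv
  have hC0 : 0 ≤ C := by simpa using (abs_nonneg _).trans (hC 1 le_rfl)
  have hp2 : ∀ r : ℕ, Summable fun n : ℕ => C / (n : ℝ) ^ (r + 2) := fun r => by
    simpa [div_eq_mul_inv] using
      (Real.summable_nat_pow_inv.2 (by omega : 1 < r + 2)).mul_left C
  have hcos : Summable fun n => |cosCoeff f n| := by
    refine Summable.of_norm_bounded_eventually_nat (hp2 (m - 1 + ℓ)) ?_
    filter_upwards [Filter.eventually_ge_atTop 1] with n hn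
    simpa using hC n hn
  set a : ℕ → ℝ := fun n => (if n = 0 then 1 / 2 else 1) * chebyshevCoeff f n with ha
  have hale : ∀ n : ℕ, 1 ≤ n → |a n| ≤ C / (n : ℝ) ^ (m - 1 + ℓ + 2) := by
    intro n hn
    rw [ha]
    simp only [if_neg (by omega : ¬ n = 0), one_mul]
    rw [chebyshevCoeff_eq_cosCoeff, abs_mul, abs_of_pos (by positivity : 0 < 2 / Real.pi)]
    refine (mul_le_of_le_one_left (abs_nonneg _) ?_).trans (hC n hn)
    rw [div_le_one Real.pi_pos]
    exact Real.two_le_pi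
  -- Of the decay exponent m+ℓ+1, at most m-1 is spent on derivatives, which leaves ℓ+2.
  have hals : ∀ s < m, ∀ n : ℕ, 1 ≤ n → |a n| * (n : ℝ) ^ s ≤ C / (n : ℝ) ^ (ℓ + 2) := by
    intro s hs n hn
    have hn1 : (1 : ℝ) ≤ n := by exact_mod_cast hn
    have hn0 : (0 : ℝ) < n := by exact_mod_cast hn
    calc |a n| * (n : ℝ) ^ s ≤ C / (n : ℝ) ^ (m - 1 + ℓ + 2) * (n : ℝ) ^ (m - 1) := by
          gcongr
          · exact hale n hn
          · omega
      _ = C / (n : ℝ) ^ (ℓ + 2) := by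
          rw [add_assoc, pow_add]
          field_simp
  have hsm : ∀ s < m, Summable fun n : ℕ => |a n| * (n : ℝ) ^ s := by
    intro s hs
    refine Summable.of_norm_bounded_eventually_nat (hp2 ℓ) ?_
    filter_upwards [Filter.eventually_ge_atTop 1] with n hn
    rw [Real.norm_of_nonneg (by positivity)]
    exact hals s hs n hn
  have hpt : ∀ x ∈ Set.Icc (-1 : ℝ) 1,
      HasSum (fun n : ℕ => a n * (Polynomial.Chebyshev.T ℝ (n : ℤ)).eval x) (f x) :=
    fun x hx => hasSum_chebyshevCoeff_mul_eval hf.continuousOn hcos hx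
  choose c hc0 hc using fun s => exists_abs_iterate_derivative_chebyshev_le hδ1 s
  have hS0 : 0 ≤ ∑ s ∈ Finset.range m, c s := Finset.sum_nonneg fun s _ => hc0 s
  -- The sum dominates every interior constant `c s`, and the summand 1 covers |T_n| ≤ 1 on all of
  -- [-1, 1].
  refine ⟨(1 + ∑ s ∈ Finset.range m, c s) * C, by positivity, fun s hs lam hlam N hN => ?_⟩
  refine tsum_tail_le (by positivity) hN (b := fun n => a n *
    (Polynomial.derivative^[s] (Polynomial.Chebyshev.T ℝ (n : ℤ))).eval lam) (fun n hn => ?_) ?_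
  · have hT : |(Polynomial.derivative^[s] (Polynomial.Chebyshev.T ℝ (n : ℤ))).eval lam| ≤
        (1 + ∑ s ∈ Finset.range m, c s) * (n : ℝ) ^ s := by
      rcases hlam with h | ⟨rfl, h⟩
      · refine (hc s n lam (abs_le.2 ⟨h.1.le, h.2.le⟩)).trans ?_
        gcongr
        have := Finset.single_le_sum (f := c) (fun s _ => hc0 s) (Finset.mem_range.2 hs)
        linarith
      · have := Polynomial.Chebyshev.abs_eval_T_real_le_one (n : ℤ) (abs_le.2 h)
        simp only [Function.iterate_zero, id_eq, pow_zero, mul_one]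
        linarith
    calc _ = |a n| * |(Polynomial.derivative^[s]
            (Polynomial.Chebyshev.T ℝ (n : ℤ))).eval lam| := abs_mul _ _
      _ ≤ |a n| * ((1 + ∑ s ∈ Finset.range m, c s) * (n : ℝ) ^ s) := by gcongr
      _ = (1 + ∑ s ∈ Finset.range m, c s) * (|a n| * (n : ℝ) ^ s) := by ring
      _ ≤ (1 + ∑ s ∈ Finset.range m, c s) * (C / (n : ℝ) ^ (ℓ + 2)) := by
        gcongr
        exact hals s hs n hn
      _ = _ := by ring
  · rcases hlam with h | ⟨rfl, h⟩
    · exact hasSum_mul_iterate_derivative_chebyshev hδ1 hpt s (hsm s hs) h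
    · simpa using hpt lam h

theorem mainTheorem5 (k m ℓ : ℕ) (hm : 1 < m) (δ : ℝ) (hδ0 : 0 < δ) (hδ1 : δ < 1)
    (ν : AlgebraNorm ℝ (Matrix (Fin k) (Fin k) ℝ)) (f : ℝ → ℝ)
    (hf : ContDiffOn ℝ ((m - 1 + ℓ : ℕ) : ℕ∞) f (Set.Icc (-1) 1))
    (hac : AbsolutelyContinuousOnInterval
      (iteratedDerivWithin (m - 1 + ℓ) f (Set.Icc (-1) 1)) (-1) 1)
    (hbv : HasDerivOfBoundedVariation (iteratedDerivWithin (m - 1 + ℓ) f (Set.Icc (-1) 1))) :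
    ∃ C : ℝ, ∀ A : Matrix (Fin k) (Fin k) ℝ, IsDeltaCondense δ A →
      ∀ D : JordanDecomposition A, D.maxBlockSize = m →
        ∀ N : ℕ, m + ℓ < N →
          ν (chebyshevPartialSum N f A - D.matrixFunction f) ≤
            C * (ν D.Z⁻¹ * ν D.Z) * (1 / ((N : ℝ) - ((m : ℝ) + (ℓ : ℝ))) ^ (ℓ + 1)) := by
  obtain ⟨K, hK0, hK⟩ := exists_chebyshev_error_le hm hδ1 hf hac hbv
  refine ⟨(∑ i, ∑ j, ν (Matrix.single i j (1 : ℝ))) * K, fun A hA D hD N hN => ?_⟩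
  have hNm : (0 : ℝ) < (N : ℝ) - ((m : ℝ) + (ℓ : ℝ)) := by
    rw [sub_pos]
    exact_mod_cast hN
  set P : Polynomial ℝ := ∑ n ∈ Finset.range (N + 1),
    ((if n = 0 then 1 / 2 else 1) * chebyshevCoeff f n) •
      Polynomial.Chebyshev.T ℝ (n : ℤ) with hP
  have hS : chebyshevPartialSum N f A = Polynomial.aeval A P := by
    simp only [chebyshevPartialSum, hP, map_sum, map_smul]
  have hPeval : ∀ (s : ℕ) (x : ℝ), (Polynomial.derivative^[s] P).eval x =
      ∑ n ∈ Finset.range (N + 1), ((if n = 0 then 1 / 2 else 1) * chebyshevCoeff f n) *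
        (Polynomial.derivative^[s] (Polynomial.Chebyshev.T ℝ (n : ℤ))).eval x := by
    intro s x
    rw [hP, Polynomial.iterate_derivative_sum, Polynomial.eval_finsetSum]
    refine Finset.sum_congr rfl fun n _ => ?_
    rw [Polynomial.iterate_derivative_smul, Polynomial.eval_smul, smul_eq_mul]
  -- The argument yields the rate N^{-(ℓ+1)}; the stated one is weaker because 0 < N - (m+ℓ) ≤ N.
  have hε : K / (N : ℝ) ^ (ℓ + 1) ≤ K * (1 / ((N : ℝ) - ((m : ℝ) + (ℓ : ℝ))) ^ (ℓ + 1)) := by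
    rw [mul_one_div]
    gcongr
    linarith [(Nat.cast_nonneg m : (0 : ℝ) ≤ m), (Nat.cast_nonneg ℓ : (0 : ℝ) ≤ ℓ)]
  have hdiff : chebyshevPartialSum N f A - D.matrixFunction f = D.conjBlocks
      ((fun i => Polynomial.aeval (jordanBlock (D.size i) (D.eigenvalue i)) P) -
        fun i => jordanBlockFunction f (D.size i) (D.eigenvalue i)) := by
    rw [D.conjBlocks_sub, hS, D.aeval_eq_conjBlocks]
    rfl
  rw [hdiff]
  refine (D.norm_conjBlocks_le ν (by positivity) _ fun i r s => ?_).trans_eq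
    (by ring : _ * _ * (K * (1 / ((N : ℝ) - ((m : ℝ) + (ℓ : ℝ))) ^ (ℓ + 1))) = _)
  refine le_trans ?_ hε
  simp only [Pi.sub_apply, Matrix.sub_apply, aeval_jordanBlock_apply, jordanBlockFunction,
    Matrix.of_apply]
  split_ifs with hrs
  · have hsize : D.size i ≤ m := hD ▸ Finset.le_sup (f := D.size) (Finset.mem_univ i)
    have hlam := abs_le.1 (D.abs_eigenvalue_le_one hA.spectralRadius_le_one i)
    rw [← sub_div, abs_div, Nat.abs_cast, hPeval]
    refine (div_le_self (abs_nonneg _)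
      (by exact_mod_cast Nat.one_le_iff_ne_zero.2 (Nat.factorial_ne_zero _))).trans ?_
    refine hK _ (by omega) _ ?_ N (by omega)
    -- Inside (-δ, δ) every order s < m is controlled. Outside, the block has size one, so the only
    -- entry has s = 0.
    by_cases hin : D.eigenvalue i ∈ Set.Ioo (-δ) δ
    · exact Or.inl hin
    · right
      have hout : D.eigenvalue i ∈ Set.Icc (-1) (-δ) ∪ Set.Icc δ 1 := by
        rcases le_or_gt (D.eigenvalue i) (-δ) with h | h
        · exact Or.inl ⟨hlam.1, h⟩
        · exact Or.inr ⟨not_lt.1 fun h' => hin ⟨h, h'⟩, hlam.2⟩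
      have hone := D.size_eq_one_of_isSemisimple i (hA.semisimple _ (D.hasEigenvalue i) hout)
      exact ⟨by omega, hlam⟩
  · simp only [sub_zero, abs_zero]
    positivity
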